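/- Notation. For $n\ge 1$ let $S(2n)$ be the group of permutations of $\{-n,\dots,-1,1,\dots,n\}$, with permutations multiplied from left to right; $S(2n)$ is identified with the subgroup of $S(2n+2)$ fixing $\pm(n+1)$, and $S(2\infty)=\bigcup_{n\ge1}S(2n)$. Let $X(n)$ be the finite set of all pairings of $\{-n,\dots,-1,1,\dots,n\}$ into $n$ unordered pairs, on which $S(2n)$ acts from the right by $\{i,j\}\mapsto\{g(i),g(j)\}$ on pairs. $X(n)$ is regarded as a subset of $X(n+1)$ by adding the pair $\{-n-1,n+1\}$. The canonical projection $p_{n,n+1}:X(n+1)\to X(n)$ deletes the pair $\{-n-1,n+1\}$ if it is present, and otherwise replaces the pairs $\{i,-n-1\}$, $\{k,n+1\}$ by $\{i,k\}$. For $x\in X(n)$ let $[x]_n$ be the number of cycles of $x$, that is, the number of classes of the equivalence relation on $\{-n,\dots,-1,1,\dots,n\}$ generated by $i\sim-i$ and by $i\sim j$ for the pairs $\{i,j\}$ of $x$. Let $X=\varprojlim X(n)$ along the maps $p_{n,n+1}$, with projections $p_n:X\to X(n)$ and with the right action of $S(2\infty)$ given by $p_n(x\cdot g)=p_n(x)\cdot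 g$ for all $n$ with $g\in S(2n)$. For $x\in X$ and $g\in S(2\infty)$ put $c(x;g)=[p_n(x)\cdot g]_n-[p_n(x)]_n$ for any $n$ with $g\in S(2n)$ (this does not depend on $n$). For $t>0$ let $\mu_t^{(n)}$ be the probability measure on $X(n)$ with $\mu_t^{(n)}(x)=\dfrac{t^{[x]_n}}{t(t+2)\cdots(t+2n-2)}$, and let $\mu_t=\varprojlim\mu_t^{(n)}$ be the corresponding probability measure on $X$. In particular $\mu_1^{(n)}$ is the uniform probability measure on $X(n)$. Let $z$ be a nonzero complex number and $t=|z|^2$. Let $T_{z,1/2}$ be the unitary representation of $S(2\infty)$ in $L^2(X,\mu_t)$ given by $(T_{z,1/2}(g)f)(x)=z^{c(x;g)}f(x\cdot g)$. For $n\ge1$ let $Reg^n$ be the unitary representation of $S(2n)$ in $L^2(X(n),\mu_1^{(n)})$ given by $(Reg^n(g)f)(x)=f(x\cdot g)$, and define the linear operator $L_z^{(n)}:L^2(X(n),\mu_1^{(n)})\to L^2(X(n+1),\mu_1^{(n+1)})$ by $$(L_z^{(n)}f)(x)=\begin{cases} z\sqrt{\frac{2n+1}{2n+t}}\,f(x),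 & x\in X(n)\subset X(n+1),\\[4pt] \sqrt{\frac{2n+1}{2n+t}}\,f(p_{n,n+1}(x)), & x\in X(n+1)\setminus X(n).\end{cases}$$ Proposition. For every $n\ge 1$ the operator $L_z^{(n)}$ is an isometric embedding, and it intertwines the representations $Reg^n$ and $Reg^{n+1}|_{S(2n)}$ of $S(2n)$. Let $T'_{z,1/2}$ be the inductive limit of the representations $Reg^n$ along the embeddings $L_z^{(n)}$, that is, the unitary representation of $S(2\infty)$ in the Hilbert completion $H$ of $\bigcup_{n\ge1}L^2(X(n),\mu_1^{(n)})$ (the union along the embeddings $L_z^{(n)}$) which is determined by $T'_{z,1/2}(g)\xi=Reg^n(g)\xi$ for $g\in S(2n)$ and $\xi\in L^2(X(n),\mu_1^{(n)})$. Then the representations $T'_{z,1/2}$ and $T_{z,1/2}$ of $S(2\infty)$ are (unitarily) equivalent. -/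

import Mathlib

open MeasureTheory
open scoped ENNReal InnerProductSpace

noncomputable section

/-! ### Unitary representations and their inductive limits -/

/-- A unitary representation of the group `G` in the Hilbert space `H`: a homomorphism from `G` to
the group of surjective linear isometries of `H`. -/
abbrev UnitaryRep (G : Type) [Group G] (H : Type) [NormedAddCommGroup H]
    [InnerProductSpace ℂ H] : Type :=
  G →* (H ≃ₗᵢ[ℂ] H)

namespace UnitaryRep

variable {G : Type} [Group G]

/-- (Unitary) equivalence of unitary representations. -/
def Equivalent {H K : Type} [NormedAddCommGroup H] [InnerProductSpace ℂ H]
    [NormedAddCommGroup K] [InnerProductSpace ℂ K]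
    (T : UnitaryRep G H) (S : UnitaryRep G K) : Prop :=
  ∃ U : H ≃ₗᵢ[ℂ] K, ∀ (g : G) (ξ : H), U (T g ξ) = S g (U ξ)

/-- A multiplicative family of linear isometries of `H` with `T 1 = 1` is a unitary
representation. -/
def ofIsometries {H : Type} [NormedAddCommGroup H] [InnerProductSpace ℂ H]
    (T : G → H →ₗᵢ[ℂ] H) (h_one : ∀ ξ, T 1 ξ = ξ)
    (h_mul : ∀ g₁ g₂ ξ, T (g₁ * g₂) ξ = T g₁ (T g₂ ξ)) : UnitaryRep G H where
  toFun g :=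
    { toLinearEquiv := LinearEquiv.ofLinearMap (T g).toLinearMap (T g⁻¹).toLinearMap
        (by ext ξ; simp [← h_mul, h_one]) (by ext ξ; simp [← h_mul, h_one])
      norm_map' := (T g).norm_map }
  map_one' := by ext ξ; exact h_one ξ
  map_mul' g₁ g₂ := by ext ξ; exact h_mul g₁ g₂ ξ

@[simp] theorem ofIsometries_apply {H : Type} [NormedAddCommGroup H] [InnerProductSpace ℂ H]
    (T : G → H →ₗᵢ[ℂ] H) (h_one : ∀ ξ, T 1 ξ = ξ)
    (h_mul : ∀ g₁ g₂ ξ, T (g₁ * g₂) ξ = T g₁ (T g₂ ξ)) (g : G) (ξ : H) :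
    ofIsometries T h_one h_mul g ξ = T g ξ := rfl

end UnitaryRep

namespace IndLim

variable {H : ℕ → Type} [∀ n, NormedAddCommGroup (H n)] [∀ n, InnerProductSpace ℂ (H n)]

/-- The composite embedding `H m → H n` of a chain of isometric embeddings, for `m ≤ n`. -/
def trans (α : ∀ n, H n →ₗᵢ[ℂ] H (n + 1)) (m n : ℕ) (h : m ≤ n) : H m →ₗᵢ[ℂ] H n :=
  Nat.leRec (motive := fun k _ => H m →ₗᵢ[ℂ] H k) LinearIsometry.id
    (fun k _ F => (α k).comp F) h

theorem trans_self (α : ∀ n, H n →ₗᵢ[ℂ] H (n + 1)) (m : ℕ) (ξ : H m) :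
    trans α m m le_rfl ξ = ξ := by
  simp [trans, Nat.leRec_self]

theorem trans_succ (α : ∀ n, H n →ₗᵢ[ℂ] H (n + 1)) (m n : ℕ) (h : m ≤ n) (ξ : H m) :
    trans α m (n + 1) (h.trans n.le_succ) ξ = α n (trans α m n h ξ) := by
  simp [trans, Nat.leRec_succ _ _ h]

theorem trans_trans (α : ∀ n, H n →ₗᵢ[ℂ] H (n + 1)) {k m n : ℕ} (h₁ : k ≤ m) (h₂ : m ≤ n)
    (ξ : H k) : trans α m n h₂ (trans α k m h₁ ξ) = trans α k n (h₁.trans h₂) ξ := by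
  induction n, h₂ using Nat.le_induction with
  | base => rw [trans_self]
  | succ n h ih => rw [trans_succ α m n h, ih, ← trans_succ α k n (h₁.trans h)]

instance directedSystem (α : ∀ n, H n →ₗᵢ[ℂ] H (n + 1)) :
    DirectedSystem H (fun _ _ h => trans α _ _ h) where
  map_self _ x := trans_self α _ x
  map_map _ _ _ h₁ h₂ x := trans_trans α h₁ h₂ x

/-- The union `⋃ₙ H n` along the embeddings `α`: the direct limit of vector spaces. -/
def UnionSpace (α : ∀ n, H n →ₗᵢ[ℂ] H (n + 1)) : Type :=
  DirectLimit H (fun i j h => trans α i j h)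

variable (α : ∀ n, H n →ₗᵢ[ℂ] H (n + 1))

instance : AddCommGroup (UnionSpace α) :=
  inferInstanceAs (AddCommGroup (DirectLimit H (fun i j h => trans α i j h)))

instance : Module ℂ (UnionSpace α) :=
  inferInstanceAs (Module ℂ (DirectLimit H (fun i j h => trans α i j h)))

/-- The inclusion of `H n` in the union. -/
def incl (n : ℕ) : H n →ₗ[ℂ] UnionSpace α where
  toFun ξ := (⟦⟨n, ξ⟩⟧ : DirectLimit H (fun i j h => trans α i j h))
  map_add' x y := (DirectLimit.add_def (f := fun i j h => trans α i j h) n x y).symm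
  map_smul' c x := (DirectLimit.smul_def (f := fun i j h => trans α i j h) n x c).symm

theorem incl_trans {m n : ℕ} (h : m ≤ n) (ξ : H m) : incl α n (trans α m n h ξ) = incl α m ξ :=
  DirectLimit.mk_apply (f := fun i j h => trans α i j h) m n ξ h

theorem exists_incl (x : UnionSpace α) : ∃ n ξ, x = incl α n ξ :=
  DirectLimit.exists_eq_mk (fun i j h => trans α i j h) x

theorem exists_incl₂ (x y : UnionSpace α) : ∃ n ξ η, x = incl α n ξ ∧ y = incl α n η :=
  DirectLimit.exists_eq_mk₂ (fun i j h => trans α i j h) x y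

/-- The inner product of the union, which extends the inner products of all the `H n`. -/
instance : Inner ℂ (UnionSpace α) where
  inner := DirectLimit.lift₂ (fun i j h => trans α i j h) (fun i j h => trans α i j h)
    (fun _ ξ η => ⟪ξ, η⟫_ℂ) (fun i j h ξ η => ((trans α i j h).inner_map_map ξ η).symm)

theorem inner_incl (n : ℕ) (ξ η : H n) : ⟪incl α n ξ, incl α n η⟫_ℂ = ⟪ξ, η⟫_ℂ :=
  DirectLimit.lift₂_def (fun i j h => trans α i j h) (fun i j h => trans α i j h) _ _ n ξ η

/-- The pre-Hilbert space structure of the union. -/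
abbrev core : InnerProductSpace.Core ℂ (UnionSpace α) where
  conj_inner_symm x y := by
    obtain ⟨n, ξ, η, rfl, rfl⟩ := exists_incl₂ α x y
    simp only [inner_incl]; exact inner_conj_symm ξ η
  re_inner_nonneg x := by
    obtain ⟨n, ξ, rfl⟩ := exists_incl α x
    rw [inner_incl]; exact inner_self_nonneg
  add_left x y w := by
    obtain ⟨n, ξ, η, rfl, rfl⟩ := exists_incl₂ α x y
    obtain ⟨m, ζ, rfl⟩ := exists_incl α w
    rw [← incl_trans α (le_max_left n m), ← incl_trans α (le_max_left n m) η,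
      ← incl_trans α (le_max_right n m), ← map_add]
    simp only [inner_incl, inner_add_left]
  smul_left x y c := by
    obtain ⟨n, ξ, η, rfl, rfl⟩ := exists_incl₂ α x y
    rw [← map_smul, inner_incl, inner_incl, inner_smul_left]
  definite x hx := by
    obtain ⟨n, ξ, rfl⟩ := exists_incl α x
    rw [inner_incl, inner_self_eq_zero] at hx
    rw [hx, map_zero]

instance : NormedAddCommGroup (UnionSpace α) := (core α).toNormedAddCommGroup

instance : InnerProductSpace ℂ (UnionSpace α) := InnerProductSpace.ofCore (core α).toCore

theorem norm_incl (n : ℕ) (ξ : H n) : ‖incl α n ξ‖ = ‖ξ‖ := by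
  rw [@norm_eq_sqrt_re_inner ℂ, @norm_eq_sqrt_re_inner ℂ _ _ _ _ ξ, inner_incl]

/-- The inductive limit of Hilbert spaces: the Hilbert completion of the union. -/
abbrev Space : Type := UniformSpace.Completion (UnionSpace α)

/-- The isometric embedding of `H n` in the inductive limit. -/
def embed (n : ℕ) : H n →ₗᵢ[ℂ] Space α :=
  (UniformSpace.Completion.toComplₗᵢ (𝕜 := ℂ) (E := UnionSpace α)).comp ⟨incl α n, norm_incl α n⟩

theorem embed_trans {m n : ℕ} (h : m ≤ n) (ξ : H m) :
    embed α n (trans α m n h ξ) = embed α m ξ :=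
  congrArg (fun x : UnionSpace α => (x : Space α)) (incl_trans α h ξ)

theorem dense_embed : Dense {x : Space α | ∃ n ξ, x = embed α n ξ} := by
  refine (UniformSpace.Completion.denseRange_coe (α := UnionSpace α)).mono ?_
  rintro _ ⟨x, rfl⟩
  obtain ⟨n, ξ, rfl⟩ := exists_incl α x
  exact ⟨n, ξ, rfl⟩

/-- Two bounded operators on the limit that agree on all the `H n` are equal. -/
theorem ext_embed {F F' : Space α →ₗᵢ[ℂ] Space α}
    (h : ∀ n ξ, F (embed α n ξ) = F' (embed α n ξ)) (x : Space α) : F x = F' x := by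
  refine congrFun (Continuous.ext_on (dense_embed α) F.continuous F'.continuous ?_) x
  rintro _ ⟨n, ξ, rfl⟩
  exact h n ξ

variable {Γ : Type} [Group Γ] {G : ℕ → Subgroup Γ} (hG : Monotone G)
  (T : ∀ n, UnitaryRep (G n) (H n))

theorem trans_intertwines
    (hT : ∀ (n : ℕ) (g : G n) (ξ : H n),
      α n (T n g ξ) = T (n + 1) (Subgroup.inclusion (hG n.le_succ) g) (α n ξ))
    {m n : ℕ} (h : m ≤ n) (g : G m) (ξ : H m) :
    trans α m n h (T m g ξ) = T n (Subgroup.inclusion (hG h) g) (trans α m n h ξ) := by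
  induction n, h using Nat.le_induction with
  | base => rw [trans_self, trans_self]; rfl
  | succ n h ih => rw [trans_succ α m n h, ih, hT, trans_succ α m n h]; rfl

theorem exists_stage (hG : Monotone G) (g : (⨆ n, G n : Subgroup Γ)) : ∃ n, (g : Γ) ∈ G n :=
  (Subgroup.mem_iSup_of_directed hG.directed_le).1 g.2

/-- The operator of the inductive limit representation on the union. -/
theorem exists_unionMap
    (hT : ∀ (n : ℕ) (g : G n) (ξ : H n),
      α n (T n g ξ) = T (n + 1) (Subgroup.inclusion (hG n.le_succ) g) (α n ξ))
    (g : (⨆ n, G n : Subgroup Γ)) :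
    ∃ F : UnionSpace α →ₗᵢ[ℂ] UnionSpace α,
      ∀ (n : ℕ) (h : (g : Γ) ∈ G n) (ξ : H n), F (incl α n ξ) = incl α n (T n ⟨g, h⟩ ξ) := by
  obtain ⟨N, hN⟩ := exists_stage hG g
  have hm : ∀ n, (g : Γ) ∈ G (max n N) := fun n => hG (le_max_right n N) hN
  let φ : ∀ n, H n → UnionSpace α := fun n ξ =>
    incl α (max n N) (T (max n N) ⟨g, hm n⟩ (trans α n (max n N) (le_max_left n N) ξ))
  have key : ∀ (n k : ℕ) (hk : n ≤ k) (h : (g : Γ) ∈ G k) (ξ : H n),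
      φ n ξ = incl α k (T k ⟨g, h⟩ (trans α n k hk ξ)) := by
    intro n k hk h ξ
    have hle₁ : max n N ≤ max k N := max_le_max hk le_rfl
    have hle₂ : k ≤ max k N := le_max_left _ _
    simp only [φ]
    rw [← incl_trans α hle₁, ← incl_trans α hle₂ (T k _ _), trans_intertwines α hG T hT hle₁,
      trans_intertwines α hG T hT hle₂, trans_trans, trans_trans]
    rfl
  let F : UnionSpace α → UnionSpace α := DirectLimit.lift (fun i j h => trans α i j h) φ (by
    intro i j h ξ
    rw [key i (max j N) (h.trans (le_max_left _ _)) (hm j), ← trans_trans α h (le_max_left j N)])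
  have hF : ∀ n ξ, F (incl α n ξ) = φ n ξ := fun n ξ => rfl
  have hF' : ∀ (n : ℕ) (h : (g : Γ) ∈ G n) (ξ : H n),
      F (incl α n ξ) = incl α n (T n ⟨g, h⟩ ξ) := by
    intro n h ξ
    rw [hF, key n n le_rfl h, trans_self]
  have hx : ∀ x : UnionSpace α, ∃ (n : ℕ) (_ : (g : Γ) ∈ G n) (ξ : H n), x = incl α n ξ := by
    intro x
    obtain ⟨n, ξ, rfl⟩ := exists_incl α x
    exact ⟨max n N, hm n, trans α n _ (le_max_left _ _) ξ, (incl_trans α _ ξ).symm⟩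
  have hx₂ : ∀ x y : UnionSpace α, ∃ (n : ℕ) (_ : (g : Γ) ∈ G n) (ξ η : H n),
      x = incl α n ξ ∧ y = incl α n η := by
    intro x y
    obtain ⟨n, ξ, η, rfl, rfl⟩ := exists_incl₂ α x y
    exact ⟨max n N, hm n, trans α n _ (le_max_left _ _) ξ, trans α n _ (le_max_left _ _) η,
      (incl_trans α _ ξ).symm, (incl_trans α _ η).symm⟩
  refine ⟨⟨{ toFun := F, map_add' := ?_, map_smul' := ?_ }, ?_⟩, hF'⟩
  · intro x y
    obtain ⟨n, h, ξ, η, rfl, rfl⟩ := hx₂ x y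
    rw [← map_add, hF' n h, hF' n h, hF' n h, map_add, map_add]
  · intro c x
    obtain ⟨n, h, ξ, rfl⟩ := hx x
    rw [← map_smul, hF' n h, hF' n h, map_smul, map_smul, RingHom.id_apply]
  · intro x
    obtain ⟨n, h, ξ, rfl⟩ := hx x
    change ‖F (incl α n ξ)‖ = _
    rw [hF' n h, norm_incl, norm_incl, LinearIsometryEquiv.norm_map]

/-- The operators of the inductive limit exist (and are determined by the stated condition). -/
theorem exists_map
    (hT : ∀ (n : ℕ) (g : G n) (ξ : H n),
      α n (T n g ξ) = T (n + 1) (Subgroup.inclusion (hG n.le_succ) g) (α n ξ))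
    (g : (⨆ n, G n : Subgroup Γ)) :
    ∃ F : Space α →ₗᵢ[ℂ] Space α,
      ∀ (n : ℕ) (h : (g : Γ) ∈ G n) (ξ : H n), F (embed α n ξ) = embed α n (T n ⟨g, h⟩ ξ) := by
  obtain ⟨F, hF⟩ := exists_unionMap α hG T hT g
  let F₁ : UnionSpace α →L[ℂ] Space α :=
    (UniformSpace.Completion.toComplₗᵢ (𝕜 := ℂ) (E := UnionSpace α)).toContinuousLinearMap.comp
      F.toContinuousLinearMap
  let e : UnionSpace α →L[ℂ] Space α := UniformSpace.Completion.toComplL (𝕜 := ℂ) (E := UnionSpace α)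
  have hd : DenseRange e := UniformSpace.Completion.denseRange_coe
  have hu : IsUniformInducing e := UniformSpace.Completion.isUniformInducing_coe _
  have hext : ∀ x : UnionSpace α, F₁.extend e (e x) = F₁ x := fun x => F₁.extend_eq hd hu x
  refine ⟨⟨(F₁.extend e).toLinearMap, ?_⟩, ?_⟩
  · intro x
    refine UniformSpace.Completion.induction_on x ?_ ?_
    · exact isClosed_eq (F₁.extend e).continuous.norm continuous_norm
    · intro y
      change ‖F₁.extend e (e y)‖ = _
      rw [hext]
      change ‖((F y : UnionSpace α) : Space α)‖ = _
      rw [UniformSpace.Completion.norm_coe, UniformSpace.Completion.norm_coe, F.norm_map]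
  · intro n h ξ
    change F₁.extend e (e (incl α n ξ)) = _
    rw [hext]
    change ((F (incl α n ξ) : UnionSpace α) : Space α) = _
    rw [hF n h]
    rfl

/-- The inductive limit of the unitary representations `T n` of the groups `G n` along the
intertwining isometric embeddings `α n`: the unitary representation `T` of `⋃ₙ G n` in the
completion of `⋃ₙ H n` such that `T g ξ = T n g ξ` for `g ∈ G n` and `ξ ∈ H n`. -/
def rep
    (hT : ∀ (n : ℕ) (g : G n) (ξ : H n),
      α n (T n g ξ) = T (n + 1) (Subgroup.inclusion (hG n.le_succ) g) (α n ξ)) :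
    UnitaryRep (⨆ n, G n : Subgroup Γ) (Space α) :=
  UnitaryRep.ofIsometries (fun g => Classical.choose (exists_map α hG T hT g))
    (by
      refine ext_embed α (F' := LinearIsometry.id) fun n ξ => ?_
      rw [Classical.choose_spec (exists_map α hG T hT 1) n (G n).one_mem]
      have : (⟨((1 : (⨆ n, G n : Subgroup Γ)) : Γ), (G n).one_mem⟩ : G n) = 1 := rfl
      rw [this, map_one]; rfl)
    (by
      intro g₁ g₂
      refine ext_embed α (F' := (Classical.choose (exists_map α hG T hT g₁)).comp
        (Classical.choose (exists_map α hG T hT g₂))) fun n ξ => ?_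
      obtain ⟨N₁, h₁⟩ := exists_stage hG g₁
      obtain ⟨N₂, h₂⟩ := exists_stage hG g₂
      set m := max n (max N₁ N₂) with hm
      have k₁ : (g₁ : Γ) ∈ G m := hG (by omega) h₁
      have k₂ : (g₂ : Γ) ∈ G m := hG (by omega) h₂
      rw [← embed_trans α (show n ≤ m by omega) ξ]
      rw [Classical.choose_spec (exists_map α hG T hT (g₁ * g₂)) m ((G m).mul_mem k₁ k₂)]
      rw [show ∀ (A B : Space α →ₗᵢ[ℂ] Space α) x, A.comp B x = A (B x) from fun _ _ _ => rfl,
        Classical.choose_spec (exists_map α hG T hT g₂) m k₂,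
        Classical.choose_spec (exists_map α hG T hT g₁) m k₁]
      have : (⟨((g₁ * g₂ : (⨆ n, G n : Subgroup Γ)) : Γ), (G m).mul_mem k₁ k₂⟩ : G m)
          = ⟨g₁, k₁⟩ * ⟨g₂, k₂⟩ := rfl
      rw [this, map_mul]; rfl)

theorem rep_embed
    (hT : ∀ (n : ℕ) (g : G n) (ξ : H n),
      α n (T n g ξ) = T (n + 1) (Subgroup.inclusion (hG n.le_succ) g) (α n ξ))
    (g : (⨆ n, G n : Subgroup Γ)) (n : ℕ) (h : (g : Γ) ∈ G n) (ξ : H n) :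
    rep α hG T hT g (embed α n ξ) = embed α n (T n ⟨g, h⟩ ξ) :=
  Classical.choose_spec (exists_map α hG T hT g) n h ξ

end IndLim

/-! ### The representation defined by a multiplicative cocycle -/

/-- `act` is a right action of the group `G` on the measure space `(X, μ)` that preserves the
measurable structure, `τ` is a nonvanishing multiplicative cocycle, and the measure `μ` is
quasi-invariant with `dμ(x · g) = |τ(x; g)|² dμ(x)`. -/
structure IsCocycle {G X : Type} [Group G] [MeasurableSpace X] (μ : Measure X)
    (act : X → G → X) (τ : X → G → ℂ) : Prop where
  act_one : ∀ x, act x 1 = x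
  act_mul : ∀ x g₁ g₂, act x (g₁ * g₂) = act (act x g₁) g₂
  measurable_act : ∀ g, Measurable fun x => act x g
  measurable_cocycle : ∀ g, Measurable fun x => τ x g
  cocycle_ne_zero : ∀ x g, τ x g ≠ 0
  cocycle_mul : ∀ x g₁ g₂, τ x (g₁ * g₂) = τ (act x g₁) g₂ * τ x g₁
  map_eq : ∀ g, (μ.withDensity fun x => ‖τ x g‖ₑ ^ 2).map (fun x => act x g) = μ

namespace IsCocycle

variable {G X : Type} [Group G] [MeasurableSpace X] {μ : Measure X}
  {act : X → G → X} {τ : X → G → ℂ}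

theorem cocycle_one (h : IsCocycle μ act τ) (x : X) : τ x 1 = 1 := by
  have h₁ := h.cocycle_mul x 1 1
  rw [mul_one, h.act_one] at h₁
  exact (mul_eq_left₀ (h.cocycle_ne_zero x 1)).1 h₁.symm

theorem quasi (h : IsCocycle μ act τ) (g : G) :
    Measure.QuasiMeasurePreserving (fun x => act x g) μ μ := by
  refine ⟨h.measurable_act g, ?_⟩
  have hm : Measurable fun x => ‖τ x g‖ₑ ^ 2 := (h.measurable_cocycle g).enorm.pow_const 2
  have h₁ : μ ≪ μ.withDensity fun x => ‖τ x g‖ₑ ^ 2 :=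
    withDensity_absolutelyContinuous' hm.aemeasurable
      (Filter.Eventually.of_forall fun x => by simp [h.cocycle_ne_zero x g])
  have h₂ := h₁.map (h.measurable_act g)
  rwa [h.map_eq g] at h₂

theorem aestronglyMeasurable (h : IsCocycle μ act τ) (g : G) {f : X → ℂ}
    (hf : AEStronglyMeasurable f μ) :
    AEStronglyMeasurable (fun x => τ x g * f (act x g)) μ :=
  (h.measurable_cocycle g).aestronglyMeasurable.mul (hf.comp_quasiMeasurePreserving (h.quasi g))

theorem eLpNorm_eq (h : IsCocycle μ act τ) (g : G) {f : X → ℂ}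
    (hf : AEStronglyMeasurable f μ) :
    eLpNorm (fun x => τ x g * f (act x g)) 2 μ = eLpNorm f 2 μ := by
  have hm : Measurable fun x => ‖τ x g‖ₑ ^ 2 := (h.measurable_cocycle g).enorm.pow_const 2
  have hF : AEMeasurable (fun x => ‖f x‖ₑ ^ 2) μ := hf.enorm.pow_const 2
  rw [eLpNorm_eq_lintegral_rpow_enorm_toReal (by norm_num) (by norm_num),
    eLpNorm_eq_lintegral_rpow_enorm_toReal (by norm_num) (by norm_num)]
  congr 1
  simp only [ENNReal.toReal_ofNat, ENNReal.rpow_ofNat, enorm_mul, mul_pow]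
  calc ∫⁻ x, ‖τ x g‖ₑ ^ 2 * ‖f (act x g)‖ₑ ^ 2 ∂μ
      = ∫⁻ x, ‖f (act x g)‖ₑ ^ 2 ∂(μ.withDensity fun x => ‖τ x g‖ₑ ^ 2) := by
        exact (lintegral_withDensity_eq_lintegral_mul₀ hm.aemeasurable
          (hF.comp_quasiMeasurePreserving (h.quasi g))).symm
    _ = ∫⁻ y, ‖f y‖ₑ ^ 2 ∂((μ.withDensity fun x => ‖τ x g‖ₑ ^ 2).map fun x => act x g) := by
        rw [lintegral_map' (by rwa [h.map_eq g]) (h.measurable_act g).aemeasurable]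
    _ = ∫⁻ y, ‖f y‖ₑ ^ 2 ∂μ := by rw [h.map_eq g]

theorem memLp (h : IsCocycle μ act τ) (g : G) (f : Lp ℂ 2 μ) :
    MemLp (fun x => τ x g * f (act x g)) 2 μ :=
  ⟨h.aestronglyMeasurable g (Lp.aestronglyMeasurable f), by
    rw [h.eLpNorm_eq g (Lp.aestronglyMeasurable f)]; exact Lp.eLpNorm_lt_top f⟩

/-- The operator `(T(g) f)(x) = τ(x; g) f(x · g)` in `L²(X, μ)`. -/
def op (h : IsCocycle μ act τ) (g : G) : Lp ℂ 2 μ →ₗᵢ[ℂ] Lp ℂ 2 μ where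
  toFun f := (h.memLp g f).toLp fun x => τ x g * f (act x g)
  map_add' f₁ f₂ := by
    refine Lp.ext ?_
    filter_upwards [(h.memLp g (f₁ + f₂)).coeFn_toLp, (h.memLp g f₁).coeFn_toLp,
      (h.memLp g f₂).coeFn_toLp, Lp.coeFn_add ((h.memLp g f₁).toLp _) ((h.memLp g f₂).toLp _),
      (h.quasi g).ae (Lp.coeFn_add f₁ f₂)] with x h₁ h₂ h₃ h₄ h₅
    rw [h₁, h₄, Pi.add_apply, h₂, h₃, h₅, Pi.add_apply, mul_add]
  map_smul' c f := by
    refine Lp.ext ?_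
    filter_upwards [(h.memLp g (c • f)).coeFn_toLp, (h.memLp g f).coeFn_toLp,
      Lp.coeFn_smul c ((h.memLp g f).toLp _),
      (h.quasi g).ae (Lp.coeFn_smul c f)] with x h₁ h₂ h₃ h₄
    rw [h₁, RingHom.id_apply, h₃, Pi.smul_apply, h₂, h₄, Pi.smul_apply, smul_eq_mul, smul_eq_mul,
      mul_left_comm]
  norm_map' f := by
    change ‖(h.memLp g f).toLp _‖ = _
    rw [Lp.norm_toLp, h.eLpNorm_eq g (Lp.aestronglyMeasurable f), Lp.norm_def]

theorem coeFn_op (h : IsCocycle μ act τ) (g : G) (f : Lp ℂ 2 μ) :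
    h.op g f =ᵐ[μ] fun x => τ x g * f (act x g) :=
  (h.memLp g f).coeFn_toLp

/-- The unitary representation `(T(g) f)(x) = τ(x; g) f(x · g)` of `G` in `L²(X, μ)`. -/
def rep (h : IsCocycle μ act τ) : UnitaryRep G (Lp ℂ 2 μ) :=
  UnitaryRep.ofIsometries h.op
    (fun f => Lp.ext <| by
      filter_upwards [h.coeFn_op 1 f] with x hx
      rw [hx, h.cocycle_one, h.act_one, one_mul])
    (fun g₁ g₂ f => Lp.ext <| by
      filter_upwards [h.coeFn_op (g₁ * g₂) f, h.coeFn_op g₁ (h.op g₂ f),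
        (h.quasi g₁).ae (h.coeFn_op g₂ f)] with x h₁ h₂ h₃
      rw [h₁, h₂, h₃, h.act_mul, h.cocycle_mul]
      ring)

theorem coeFn_rep (h : IsCocycle μ act τ) (g : G) (f : Lp ℂ 2 μ) :
    h.rep g f =ᵐ[μ] fun x => τ x g * f (act x g) :=
  h.coeFn_op g f

end IsCocycle

/-! ### Pairings -/

/-- The set `{-n, …, -1, 1, …, n}`. -/
def pts (n : ℕ) : Finset ℤ := (Finset.Icc (-(n : ℤ)) n).erase 0

theorem mem_pts {n : ℕ} {i : ℤ} : i ∈ pts n ↔ i ≠ 0 ∧ -(n : ℤ) ≤ i ∧ i ≤ n := by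
  simp [pts]

/-- The space `X(n)` of pairings of `{-n, …, -1, 1, …, n}` into `n` unordered pairs. A pairing is
given by the map that sends every point to the other point of its pair: `{i, j}` is a pair of `x` iff
`x.partner i = j`, for `i` in `{-n, …, -1, 1, …, n}`. The integers outside of
`{-n, …, -1, 1, …, n}` belong to no pair; for them `x.partner i = i` by convention. -/
@[ext]
structure Pairing (n : ℕ) where
  partner : ℤ → ℤ
  partner_partner : ∀ i, partner (partner i) = i
  partner_eq_self_iff : ∀ i, partner i = i ↔ i ∉ pts n

namespace Pairing

variable {n : ℕ}

theorem partner_mem (x : Pairing n) {i : ℤ} (hi : i ∈ pts n) : x.partner i ∈ pts n := by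
  by_contra h
  have h₁ := (x.partner_eq_self_iff _).2 h
  rw [x.partner_partner] at h₁
  exact h (h₁ ▸ hi)

theorem partner_ne (x : Pairing n) {i : ℤ} (hi : i ∈ pts n) : x.partner i ≠ i :=
  fun h => (x.partner_eq_self_iff i).1 h hi

theorem partner_of_notMem (x : Pairing n) {i : ℤ} (hi : i ∉ pts n) : x.partner i = i :=
  (x.partner_eq_self_iff i).2 hi

theorem partner_inj (x : Pairing n) {i j : ℤ} (h : x.partner i = x.partner j) : i = j := by
  rw [← x.partner_partner i, h, x.partner_partner]

instance : Finite (Pairing n) := by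
  refine Finite.of_injective
    (fun (x : Pairing n) (i : pts n) => (⟨x.partner i, x.partner_mem i.2⟩ : pts n)) ?_
  intro x y h
  ext i
  by_cases hi : i ∈ pts n
  · exact congrArg Subtype.val (congrFun h ⟨i, hi⟩)
  · rw [x.partner_of_notMem hi, y.partner_of_notMem hi]

instance : MeasurableSpace (Pairing n) := ⊤

instance : DiscreteMeasurableSpace (Pairing n) := ⟨fun _ => trivial⟩

/-- The number `[x]_n` of cycles of `x`. A cycle is an alternating sequence of pairs `{i, j}` of `x`
and of steps from `i` to `-i`, so that the cycles are the classes of the equivalence relation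
generated by `i ∼ -i` and by `i ∼ j` for all pairs `{i, j}` of `x`. -/
def cycles (x : Pairing n) : ℕ :=
  Nat.card (Quot fun i j : pts n => (j : ℤ) = -i ∨ (j : ℤ) = x.partner i)

/-- The embedding of `X(n)` in `X(n+1)` which adds the pair `{-n-1, n+1}`. -/
def extend (x : Pairing n) : Pairing (n + 1) where
  partner i := if i = n + 1 then -(n + 1) else if i = -(n + 1) then n + 1 else x.partner i
  partner_partner i := by
    have h₁ : (n + 1 : ℤ) ∉ pts n := by simp [mem_pts]
    have h₂ : (-(n + 1) : ℤ) ∉ pts n := by simp [mem_pts]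
    have h₃ := x.partner_of_notMem h₁
    have h₄ := x.partner_of_notMem h₂
    have h₅ := x.partner_partner i
    split_ifs <;> grind
  partner_eq_self_iff i := by
    have h₁ := x.partner_eq_self_iff i
    simp only [mem_pts, Nat.cast_add, Nat.cast_one] at h₁ ⊢
    split_ifs <;> grind

/-- The canonical projection `p_{n,n+1} : X(n+1) → X(n)`: if `{-n-1, n+1}` is a pair, then it is
deleted; otherwise the pairs `{i, -n-1}` and `{k, n+1}` are replaced by the pair `{i, k}`. -/
def proj (x : Pairing (n + 1)) : Pairing n where
  partner i :=
    if i ∈ pts n then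
      if x.partner i = n + 1 then x.partner (-(n + 1))
      else if x.partner i = -(n + 1) then x.partner (n + 1)
      else x.partner i
    else i
  partner_partner i := by
    have h₀ : ∀ j, j ∈ pts (n + 1) ↔ j ∈ pts n ∨ j = n + 1 ∨ j = -(n + 1) := by
      intro j; simp only [mem_pts, Nat.cast_add, Nat.cast_one]; omega
    have h₁ : (n + 1 : ℤ) ∉ pts n := by simp [mem_pts]
    have h₂ : (-(n + 1) : ℤ) ∉ pts n := by simp [mem_pts]
    have h₃ := x.partner_partner
    have h₄ : ∀ j, j ∈ pts (n + 1) → x.partner j ∈ pts (n + 1) := fun j => x.partner_mem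
    have h₅ : ∀ j, j ∈ pts (n + 1) → x.partner j ≠ j := fun j => x.partner_ne
    have h₆ : (n + 1 : ℤ) ≠ -(n + 1) := by omega
    grind
  partner_eq_self_iff i := by
    have h₀ : ∀ j, j ∈ pts (n + 1) ↔ j ∈ pts n ∨ j = n + 1 ∨ j = -(n + 1) := by
      intro j; simp only [mem_pts, Nat.cast_add, Nat.cast_one]; omega
    have h₁ : (n + 1 : ℤ) ∉ pts n := by simp [mem_pts]
    have h₂ : (-(n + 1) : ℤ) ∉ pts n := by simp [mem_pts]
    have h₃ := x.partner_partner
    have h₅ : ∀ j, j ∈ pts (n + 1) → x.partner j ≠ j := fun j => x.partner_ne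
    have h₆ : (n + 1 : ℤ) ≠ -(n + 1) := by omega
    grind

/-- If `{-n-1, n+1}` is not a pair of `x`, the projection does not change the number of cycles; if it
is, one cycle is deleted. -/
theorem cycles_proj (x : Pairing (n + 1)) :
    x.cycles = x.proj.cycles + if x.partner (n + 1) = -(n + 1) then 1 else 0 := by
  have h₀ : ∀ j, j ∈ pts (n + 1) ↔ j ∈ pts n ∨ j = n + 1 ∨ j = -(n + 1) := by
    intro j; simp only [mem_pts, Nat.cast_add, Nat.cast_one]; omega
  have h₁ : (n + 1 : ℤ) ∉ pts n := by simp [mem_pts]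
  have h₂ : (-(n + 1) : ℤ) ∉ pts n := by simp [mem_pts]
  have h₃ := x.partner_partner
  have h₄ : ∀ j, j ∈ pts (n + 1) → x.partner j ∈ pts (n + 1) := fun j => x.partner_mem
  have h₅ : ∀ j, j ∈ pts (n + 1) → x.partner j ≠ j := fun j => x.partner_ne
  have h₆ : (n + 1 : ℤ) ≠ -(n + 1) := by omega
  have hneg : ∀ j, j ∈ pts n → -j ∈ pts n := by intro j; simp only [mem_pts]; omega
  have ha : (n + 1 : ℤ) ∈ pts (n + 1) := by rw [h₀]; simp
  have hb : (-(n + 1) : ℤ) ∈ pts (n + 1) := by rw [h₀]; simp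
  let a : pts (n + 1) := ⟨n + 1, ha⟩
  let b : pts (n + 1) := ⟨-(n + 1), hb⟩
  let r : pts (n + 1) → pts (n + 1) → Prop := fun i j => (j : ℤ) = -i ∨ (j : ℤ) = x.partner i
  let s : pts n → pts n → Prop := fun i j => (j : ℤ) = -i ∨ (j : ℤ) = x.proj.partner i
  have hp : ∀ i ∈ pts n, x.proj.partner i = if x.partner i = n + 1 then x.partner (-(n + 1))
      else if x.partner i = -(n + 1) then x.partner (n + 1) else x.partner i := by
    intro i hi; simp [proj, hi]
  have hcast : ∀ i, i ∈ pts n → i ∈ pts (n + 1) := fun i hi => (h₀ i).2 (Or.inl hi)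
  let c : pts n → pts (n + 1) := fun i => ⟨i, hcast i i.2⟩
  have hab : Quot.mk r a = Quot.mk r b := Quot.sound (Or.inl rfl)
  have hpar : ∀ i j : pts (n + 1), (j : ℤ) = x.partner i → Quot.mk r i = Quot.mk r j :=
    fun i j h => Quot.sound (Or.inr h)
  -- the map induced by the inclusion of the points
  have hc : ∀ i j : pts n, s i j → Quot.mk r (c i) = Quot.mk r (c j) := by
    rintro i j (h | h)
    · exact Quot.sound (Or.inl h)
    · rw [hp i i.2] at h
      split_ifs at h with k₁ k₂
      · rw [hpar (c i) a k₁.symm, hab, hpar b (c j) h]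
      · rw [hpar (c i) b k₂.symm, ← hab, hpar a (c j) h]
      · exact hpar _ _ h
  change Nat.card (Quot r) = Nat.card (Quot s) + _
  split_ifs with hx
  · have hx' : x.partner (-(n + 1)) = n + 1 := by rw [← hx, h₃]
    let f : pts (n + 1) → Option (Quot s) := fun i =>
      if h : (i : ℤ) ∈ pts n then some (Quot.mk s ⟨i, h⟩) else none
    have hf : ∀ i j, r i j → f i = f j := by
      rintro ⟨i, hi⟩ ⟨j, hj⟩ h
      have hm : i ∈ pts n ↔ j ∈ pts n := by
        rcases h with h | h <;> simp only at h <;> subst h <;> grind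
      by_cases hi' : i ∈ pts n
      · have hj' := hm.1 hi'
        simp only [f, hi', hj', dif_pos]
        congr 1
        refine Quot.sound ?_
        rcases h with h | h
        · exact Or.inl h
        · right
          rw [hp i hi']
          simp only at h ⊢
          grind
      · have hj' : j ∉ pts n := fun h => hi' (hm.2 h)
        simp only [f, hi', hj', dif_neg, not_false_eq_true]
    let e : Quot r ≃ Option (Quot s) :=
      { toFun := Quot.lift f hf
        invFun := fun o => o.elim (Quot.mk r a) (Quot.lift (fun i => Quot.mk r (c i)) hc)
        left_inv := by
          rintro ⟨i, hi⟩
          by_cases hi' : i ∈ pts n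
          · simp [f, hi', c]
          · have : i = n + 1 ∨ i = -(n + 1) := by grind
            rcases this with rfl | rfl
            · simp [f, hi', a]
            · simp only [f, hi', dif_neg, not_false_eq_true, Option.elim]
              exact hab
        right_inv := by
          rintro (_ | ⟨i, hi⟩)
          · simp [f, a, h₁]
          · simp [f, c, hi] }
    rw [Nat.card_congr e, Finite.card_option]
  · have hxa : x.partner (n + 1) ∈ pts n := by grind
    have hxb : x.partner (-(n + 1)) ∈ pts n := by grind
    have hs : Quot.mk s ⟨_, hxa⟩ = Quot.mk s ⟨_, hxb⟩ := by
      refine Quot.sound (Or.inr ?_)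
      rw [hp _ hxa]
      simp [h₃]
    let f : pts (n + 1) → Quot s := fun i =>
      if h : (i : ℤ) ∈ pts n then Quot.mk s ⟨i, h⟩ else Quot.mk s ⟨_, hxa⟩
    have hf : ∀ i j, r i j → f i = f j := by
      rintro ⟨i, hi⟩ ⟨j, hj⟩ h
      rcases h with h | h <;> simp only at h
      · subst h
        by_cases hi' : i ∈ pts n
        · simp only [f, hi', hneg i hi', dif_pos]
          exact Quot.sound (Or.inl rfl)
        · have : -i ∉ pts n := fun h => hi' (by simpa using hneg _ h)
          simp only [f, hi', this, dif_neg, not_false_eq_true]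
      · subst h
        by_cases hi' : i ∈ pts n
        · by_cases hj' : x.partner i ∈ pts n
          · simp only [f, hi', hj', dif_pos]
            refine Quot.sound (Or.inr ?_)
            rw [hp i hi']
            simp only
            grind
          · simp only [f, hi', hj', dif_pos, dif_neg, not_false_eq_true]
            have : x.partner i = n + 1 ∨ x.partner i = -(n + 1) := by grind
            rcases this with k | k
            · congr 2; rw [← k, h₃]
            · rw [hs]; congr 2; rw [← k, h₃]
        · have : i = n + 1 ∨ i = -(n + 1) := by grind
          rcases this with rfl | rfl
          · simp only [f, hi', hxa, dif_pos, dif_neg, not_false_eq_true]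
          · simp only [f, hi', hxb, dif_pos, dif_neg, not_false_eq_true]
            exact hs
    let e : Quot r ≃ Quot s :=
      { toFun := Quot.lift f hf
        invFun := Quot.lift (fun i => Quot.mk r (c i)) hc
        left_inv := by
          rintro ⟨i, hi⟩
          by_cases hi' : i ∈ pts n
          · simp [f, hi', c]
          · simp only [f, hi', dif_neg, not_false_eq_true]
            have : i = n + 1 ∨ i = -(n + 1) := by grind
            rcases this with rfl | rfl
            · exact (hpar a _ rfl).symm
            · exact ((hpar a _ rfl).symm).trans hab
        right_inv := by
          rintro ⟨i, hi⟩
          simp [f, c, hi] }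
    rw [Nat.card_congr e, add_zero]

end Pairing

/-! ### The groups `S(2n)` and `S(2∞)` and their actions -/

/-- The group `S(2n)` of permutations of `{-n, …, -1, 1, …, n}`, realized as the group of those
permutations of `ℤ` that fix all other integers, so that `S(2n) ⊆ S(2n+2)`. Permutations are
multiplied from left to right (`g₁ g₂` is `g₁` followed by `g₂`), that is, in the opposite of the
group `Equiv.Perm ℤ`: with this product `x ↦ x · g` below is a right action. -/
def S2 (n : ℕ) : Subgroup (Equiv.Perm ℤ)ᵐᵒᵖ where
  carrier := {g | ∀ i, i ∉ pts n → g.unop i = i}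
  mul_mem' {a b} ha hb i hi := by
    rw [MulOpposite.unop_mul, Equiv.Perm.mul_apply, ha i hi, hb i hi]
  one_mem' _ _ := rfl
  inv_mem' {a} ha i hi := by
    rw [MulOpposite.unop_inv, Equiv.Perm.inv_eq_iff_eq, ha i hi]

theorem S2_mono : Monotone S2 := by
  intro m n h g hg i hi
  refine hg i fun hi' => hi ?_
  rw [mem_pts] at hi' ⊢
  omega

theorem S2_succ_mono : Monotone fun n => S2 (n + 1) := fun _ _ h => S2_mono (Nat.succ_le_succ h)

/-- The group `S(2∞) = ⋃ S(2n)`, the union over `n ≥ 1`. -/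
abbrev S2inf : Subgroup (Equiv.Perm ℤ)ᵐᵒᵖ := ⨆ n, S2 (n + 1)

theorem exists_mem_S2 (g : S2inf) : ∃ n, (g : (Equiv.Perm ℤ)ᵐᵒᵖ) ∈ S2 n :=
  have ⟨n, h⟩ := (Subgroup.mem_iSup_of_directed S2_succ_mono.directed_le).1 g.2
  ⟨n + 1, h⟩

/-- The least `n` such that `g ∈ S(2∞)` lies in `S(2n)`. -/
def level (g : S2inf) : ℕ := sInf {n | (g : (Equiv.Perm ℤ)ᵐᵒᵖ) ∈ S2 n}

theorem mem_level (g : S2inf) : (g : (Equiv.Perm ℤ)ᵐᵒᵖ) ∈ S2 (level g) :=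
  Nat.sInf_mem (exists_mem_S2 g)

theorem level_le {g : S2inf} {n : ℕ} (h : (g : (Equiv.Perm ℤ)ᵐᵒᵖ) ∈ S2 n) : level g ≤ n :=
  Nat.sInf_le h

theorem S2_apply_mem {n : ℕ} {g : (Equiv.Perm ℤ)ᵐᵒᵖ} (hg : g ∈ S2 n) (i : ℤ) :
    g.unop i ∈ pts n ↔ i ∈ pts n := by
  constructor
  · intro h
    by_contra hi
    rw [hg i hi] at h
    exact hi h
  · intro h
    by_contra hi
    have h₁ := g.unop.injective (hg _ hi)
    rw [h₁] at hi
    exact hi h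

namespace Pairing

variable {n : ℕ}

/-- The right action of `S(2n)` on `X(n)`: the pairs of `x · g` are `{g(i), g(j)}` for the pairs
`{i, j}` of `x`. -/
def act (x : Pairing n) (g : S2 n) : Pairing n where
  partner i := g.1.unop (x.partner (g.1.unop⁻¹ i))
  partner_partner i := by simp [x.partner_partner]
  partner_eq_self_iff i := by
    rw [← Equiv.Perm.eq_inv_iff_eq, x.partner_eq_self_iff]
    have := S2_apply_mem g.2 (g.1.unop⁻¹ i)
    rw [← this]; simp

theorem act_one (x : Pairing n) : x.act 1 = x := rfl

theorem act_mul (x : Pairing n) (g₁ g₂ : S2 n) : x.act (g₁ * g₂) = (x.act g₁).act g₂ := rfl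

theorem proj_extend (x : Pairing n) : x.extend.proj = x := by
  have h₁ : (n + 1 : ℤ) ∉ pts n := by simp [mem_pts]
  have h₂ : (-(n + 1) : ℤ) ∉ pts n := by simp [mem_pts]
  have h₄ : ∀ j, j ∈ pts n → x.partner j ∈ pts n := fun j => x.partner_mem
  have h₅ : ∀ j, j ∉ pts n → x.partner j = j := fun j => x.partner_of_notMem
  ext i
  simp only [proj, extend]
  grind

theorem proj_act (x : Pairing (n + 1)) (g : S2 n) :
    (x.act (Subgroup.inclusion (S2_mono n.le_succ) g)).proj = x.proj.act g := by
  have ha : g.1.unop (n + 1) = n + 1 := g.2 _ (by simp [mem_pts])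
  have hb : g.1.unop (-(n + 1)) = -(n + 1) := g.2 _ (by simp [mem_pts])
  have ha' : g.1.unop⁻¹ (n + 1) = n + 1 := by rw [Equiv.Perm.inv_eq_iff_eq, ha]
  have hb' : g.1.unop⁻¹ (-(n + 1)) = -(n + 1) := by rw [Equiv.Perm.inv_eq_iff_eq, hb]
  ext i
  simp only [act, proj, Subgroup.coe_inclusion]
  have hm := S2_apply_mem g.2 (g.1.unop⁻¹ i)
  rw [show g.1.unop (g.1.unop⁻¹ i) = i by simp] at hm
  have k₁ : ∀ j, g.1.unop j = n + 1 ↔ j = n + 1 := by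
    intro j; rw [← Equiv.Perm.eq_inv_iff_eq, ha']
  have k₂ : ∀ j, g.1.unop j = -(n + 1) ↔ j = -(n + 1) := by
    intro j; rw [← Equiv.Perm.eq_inv_iff_eq, hb']
  simp only [ha', hb', k₁, k₂]
  by_cases hi : i ∈ pts n
  · rw [if_pos hi, if_pos (hm.1 hi)]
    split_ifs <;> rfl
  · rw [if_neg hi, if_neg fun h => hi (hm.2 h)]
    simp

/-- The increment of the number of cycles is stable under the projection. -/
theorem cycles_act_proj (x : Pairing (n + 1)) (g : S2 n) :
    ((x.act (Subgroup.inclusion (S2_mono n.le_succ) g)).cycles : ℤ) - x.cycles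
      = (x.proj.act g).cycles - x.proj.cycles := by
  have ha : g.1.unop (n + 1) = n + 1 := g.2 _ (by simp [mem_pts])
  have hb : g.1.unop (-(n + 1)) = -(n + 1) := g.2 _ (by simp [mem_pts])
  have ha' : g.1.unop⁻¹ (n + 1) = n + 1 := by rw [Equiv.Perm.inv_eq_iff_eq, ha]
  have hb' : g.1.unop⁻¹ (-(n + 1)) = -(n + 1) := by rw [Equiv.Perm.inv_eq_iff_eq, hb]
  have : (x.act (Subgroup.inclusion (S2_mono n.le_succ) g)).partner (n + 1) = -(n + 1)
      ↔ x.partner (n + 1) = -(n + 1) := by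
    simp only [act, Subgroup.coe_inclusion]
    rw [ha', ← Equiv.Perm.eq_inv_iff_eq, hb']
  rw [cycles_proj, cycles_proj x, proj_act]
  simp only [this]
  push_cast
  ring

end Pairing

/-! ### The projective limit `X` -/

/-- The projective limit `X` of the spaces `X(n)` along the canonical projections. (The sequences
here start with the one-point space `X(0)`, which carries no information.) -/
def PairingLimit : Type := {x : ∀ n, Pairing n // ∀ n, (x (n + 1)).proj = x n}

namespace PairingLimit

/-- The projection `p_n : X → X(n)`. -/
def coord (n : ℕ) (x : PairingLimit) : Pairing n := x.1 n

/-- The Borel structure of `X`, generated by the projections to the finite spaces `X(n)`. -/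
instance : MeasurableSpace PairingLimit :=
  inferInstanceAs (MeasurableSpace {x : ∀ n, Pairing n // ∀ n, (x (n + 1)).proj = x n})

theorem measurable_coord (n : ℕ) : Measurable (coord n) :=
  (measurable_pi_apply n).comp measurable_subtype_coe

theorem proj_coord (n : ℕ) (x : PairingLimit) : (x.coord (n + 1)).proj = x.coord n := x.2 n

theorem ext_coord {x y : PairingLimit} (h : ∀ n, x.coord n = y.coord n) : x = y :=
  Subtype.ext (funext h)

/-- Iterated projection `X(m) → X(n)` for `n ≤ m`. -/
def down {m n : ℕ} (h : n ≤ m) (x : Pairing m) : Pairing n :=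
  Nat.decreasingInduction (motive := fun k _ => Pairing k) (fun _ _ y => y.proj) x h

theorem down_self {m : ℕ} (x : Pairing m) : down le_rfl x = x :=
  Nat.decreasingInduction_self _ _

theorem proj_down {m n : ℕ} (h : n + 1 ≤ m) (x : Pairing m) :
    (down h x).proj = down (n.le_succ.trans h) x :=
  (Nat.decreasingInduction_succ_left (motive := fun k _ => Pairing k) (fun _ _ y => y.proj) x
    h _).symm

theorem down_coord {m n : ℕ} (h : n ≤ m) (x : PairingLimit) :
    down h (x.coord m) = x.coord n := by
  induction h using Nat.decreasingInduction with
  | self => exact down_self _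
  | of_succ k hk ih => rw [← proj_down hk, ih, proj_coord]

/-- The `n`-th coordinate of `x · g`: it is `x_n · g` if `g ∈ S(2n)`, and for smaller `n` it is the
projection of `x_N · g`, where `N` is the least number such that `g ∈ S(2N)`. -/
def actCoord (x : PairingLimit) (g : S2inf) (n : ℕ) : Pairing n :=
  if h : level g ≤ n then (x.coord n).act ⟨g, S2_mono h (mem_level g)⟩
  else down (not_le.1 h).le ((x.coord (level g)).act ⟨g, mem_level g⟩)

theorem actCoord_of_le (x : PairingLimit) {g : S2inf} {n : ℕ} (h : level g ≤ n) :
    actCoord x g n = (x.coord n).act ⟨g, S2_mono h (mem_level g)⟩ :=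
  dif_pos h

theorem actCoord_of_ge (x : PairingLimit) {g : S2inf} {n : ℕ} (h : n ≤ level g) :
    actCoord x g n = down h ((x.coord (level g)).act ⟨g, mem_level g⟩) := by
  rcases h.lt_or_eq with h' | h'
  · exact dif_neg (not_le.2 h')
  · subst h'
    rw [actCoord_of_le x le_rfl, down_self]

/-- The right action of `S(2∞)` on `X`: if `y = x · g`, then `y_n = x_n · g` for all `n` so large
that `g ∈ S(2n)`. -/
def act (x : PairingLimit) (g : S2inf) : PairingLimit :=
  ⟨actCoord x g, by
    intro n
    by_cases h : level g ≤ n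
    · rw [actCoord_of_le x h, actCoord_of_le x (h.trans n.le_succ), ← proj_coord n x]
      exact Pairing.proj_act (x.coord (n + 1)) ⟨g, S2_mono h (mem_level g)⟩
    · rw [actCoord_of_ge x (not_le.1 h).le, actCoord_of_ge x (Nat.succ_le_of_lt (not_le.1 h)),
        proj_down]⟩

theorem coord_act (x : PairingLimit) (g : S2inf) (n : ℕ) (h : (g : (Equiv.Perm ℤ)ᵐᵒᵖ) ∈ S2 n) :
    (x.act g).coord n = (x.coord n).act ⟨g, h⟩ :=
  actCoord_of_le x (level_le h)

theorem ext_coord_ge {x y : PairingLimit} (N : ℕ) (h : ∀ n, N ≤ n → x.coord n = y.coord n) :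
    x = y := by
  refine ext_coord fun n => ?_
  rw [← down_coord (le_max_left n N), ← down_coord (le_max_left n N), h _ (le_max_right n N)]

theorem act_one (x : PairingLimit) : x.act 1 = x :=
  ext_coord fun n => by rw [coord_act x 1 n (S2 n).one_mem]; rfl

theorem act_mul (x : PairingLimit) (g₁ g₂ : S2inf) : x.act (g₁ * g₂) = (x.act g₁).act g₂ := by
  refine ext_coord_ge (max (level g₁) (level g₂)) fun n hn => ?_
  have h₁ := S2_mono ((le_max_left _ _).trans hn) (mem_level g₁)
  have h₂ := S2_mono ((le_max_right _ _).trans hn) (mem_level g₂)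
  rw [coord_act _ _ n ((S2 n).mul_mem h₁ h₂), coord_act _ _ n h₂, coord_act _ _ n h₁]
  rfl

/-- The fundamental cocycle `c(x; g) = [p_n(x) · g]_n - [p_n(x)]_n`, where `n` is so large that
`g ∈ S(2n)`. -/
def cocycle (x : PairingLimit) (g : S2inf) : ℤ :=
  ((x.coord (level g)).act ⟨g, mem_level g⟩).cycles - (x.coord (level g)).cycles

/-- The definition of the fundamental cocycle does not depend on `n`. -/
theorem cocycle_eq (x : PairingLimit) (g : S2inf) (n : ℕ)
    (h : (g : (Equiv.Perm ℤ)ᵐᵒᵖ) ∈ S2 n) :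
    x.cocycle g = ((x.coord n).act ⟨g, h⟩).cycles - (x.coord n).cycles := by
  have hn := level_le h
  induction n, hn using Nat.le_induction with
  | base => rfl
  | succ n hn ih =>
    have h' := S2_mono hn (mem_level g)
    rw [ih h', ← proj_coord n x]
    exact (Pairing.cycles_act_proj (x.coord (n + 1)) ⟨g, h'⟩).symm

theorem cocycle_mul (x : PairingLimit) (g₁ g₂ : S2inf) :
    x.cocycle (g₁ * g₂) = (x.act g₁).cocycle g₂ + x.cocycle g₁ := by
  set n := max (level g₁) (level g₂)
  have h₁ := S2_mono (le_max_left _ _ : _ ≤ n) (mem_level g₁)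
  have h₂ := S2_mono (le_max_right _ _ : _ ≤ n) (mem_level g₂)
  rw [cocycle_eq x _ n ((S2 n).mul_mem h₁ h₂), cocycle_eq x g₁ n h₁, cocycle_eq _ g₂ n h₂,
    coord_act x g₁ n h₁]
  have : (x.coord n).act ⟨(g₁ * g₂ : S2inf), (S2 n).mul_mem h₁ h₂⟩
      = ((x.coord n).act ⟨g₁, h₁⟩).act ⟨g₂, h₂⟩ := rfl
  rw [this]
  ring

theorem measurable_of_coord {α : Type} [MeasurableSpace α] {f : α → PairingLimit}
    (h : ∀ n, Measurable fun a => (f a).coord n) : Measurable f :=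
  (measurable_pi_lambda _ h).subtype_mk

theorem measurable_act (g : S2inf) : Measurable fun x => act x g := by
  refine measurable_of_coord fun n => ?_
  by_cases h : level g ≤ n
  · have : (fun x => (act x g).coord n)
        = (fun y : Pairing n => y.act ⟨g, S2_mono h (mem_level g)⟩) ∘ coord n := by
      ext1 x; exact actCoord_of_le x h
    rw [this]
    exact (measurable_of_finite _).comp (measurable_coord n)
  · have : (fun x => (act x g).coord n)
        = (fun y => down (not_le.1 h).le (Pairing.act y ⟨g, mem_level g⟩)) ∘ coord (level g) := by
      ext1 x; exact actCoord_of_ge x (not_le.1 h).le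
    rw [this]
    exact (measurable_of_finite _).comp (measurable_coord _)

end PairingLimit

/-! ### The measures -/

namespace Pairing

/-- The normalized Haar measure `μ_1^{(n)}` on the homogeneous space `X(n)`: the uniform probability
measure. -/
def haar (n : ℕ) : Measure (Pairing n) := (Nat.card (Pairing n) : ℝ≥0∞)⁻¹ • Measure.count

/-- The measure `μ_t^{(n)}` on `X(n)`: the weight of `x` is `t ^ [x]_n / (t (t+2) ⋯ (t+2n-2))`. -/
def ewens (t : ℝ) (n : ℕ) : Measure (Pairing n) :=
  Measure.count.withDensity fun x =>
    ENNReal.ofReal (t ^ x.cycles / ∏ k ∈ Finset.range n, (t + 2 * k))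

theorem count_withDensity_singleton {α : Type} [MeasurableSpace α] [DiscreteMeasurableSpace α]
    (w : α → ℝ≥0∞) (a : α) : Measure.count.withDensity w {a} = w a := by
  rw [withDensity_apply _ (measurableSet_singleton a), Measure.restrict_singleton,
    Measure.count_singleton, one_smul, lintegral_dirac]

theorem ewens_singleton (t : ℝ) (n : ℕ) (x : Pairing n) :
    ewens t n {x} = ENNReal.ofReal (t ^ x.cycles / ∏ k ∈ Finset.range n, (t + 2 * k)) :=
  count_withDensity_singleton _ x

instance : Subsingleton (Pairing 0) := by
  constructor
  intro x y
  have h : ∀ i, i ∉ pts 0 := by intro i; rw [mem_pts]; push_cast; omega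
  ext i
  rw [x.partner_of_notMem (h i), y.partner_of_notMem (h i)]

/-- The pairing of the empty set. -/
def empty : Pairing 0 where
  partner i := i
  partner_partner _ := rfl
  partner_eq_self_iff i := by
    have : i ∉ pts 0 := by rw [mem_pts]; push_cast; omega
    simpa

theorem cycles_zero (x : Pairing 0) : x.cycles = 0 := by
  have : IsEmpty (pts 0) := ⟨fun i => by have := mem_pts.1 i.2; push_cast at this; omega⟩
  have : IsEmpty (Quot fun i j : pts 0 => (j : ℤ) = -i ∨ (j : ℤ) = x.partner i) :=
    ⟨fun q => isEmptyElim q.out⟩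
  exact Nat.card_of_isEmpty

/-- The points of a fibre of the canonical projection `X(n+1) → X(n)`: the new pair `{-n-1, n+1}` is
added, or one of the `2n` points is chosen as the partner of `n+1`. -/
abbrev Code (n : ℕ) : Type := Option (pts n)

instance (n : ℕ) : MeasurableSpace (Code n) := ⊤
instance (n : ℕ) : DiscreteMeasurableSpace (Code n) := ⟨fun _ => trivial⟩

/-- The position of `x` in its fibre. -/
def code {n : ℕ} (x : Pairing (n + 1)) : Code n :=
  if h : x.partner (n + 1) ∈ pts n then some ⟨_, h⟩ else none

/-- The point of the fibre over `y` with the given position. -/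
def insert {n : ℕ} (y : Pairing n) : Code n → Pairing (n + 1)
  | none => y.extend
  | some j =>
    { partner := fun i => if i = n + 1 then j else if i = -(n + 1) then y.partner j
        else if i = j then n + 1 else if i = y.partner j then -(n + 1) else y.partner i
      partner_partner := fun i => by
        have h₁ : (n + 1 : ℤ) ∉ pts n := by simp [mem_pts]
        have h₂ : (-(n + 1) : ℤ) ∉ pts n := by simp [mem_pts]
        have h₃ := y.partner_partner
        have h₄ : ∀ j, j ∈ pts n → y.partner j ∈ pts n := fun j => y.partner_mem
        have h₅ : ∀ j, j ∈ pts n → y.partner j ≠ j := fun j => y.partner_ne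
        have h₆ : ∀ j, j ∉ pts n → y.partner j = j := fun j => y.partner_of_notMem
        have h₇ : (n + 1 : ℤ) ≠ -(n + 1) := by omega
        have hj := j.2
        grind
      partner_eq_self_iff := fun i => by
        have h₀ : ∀ j, j ∈ pts (n + 1) ↔ j ∈ pts n ∨ j = n + 1 ∨ j = -(n + 1) := by
          intro j; simp only [mem_pts, Nat.cast_add, Nat.cast_one]; omega
        have h₁ : (n + 1 : ℤ) ∉ pts n := by simp [mem_pts]
        have h₂ : (-(n + 1) : ℤ) ∉ pts n := by simp [mem_pts]
        have h₃ := y.partner_partner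
        have h₄ : ∀ j, j ∈ pts n → y.partner j ∈ pts n := fun j => y.partner_mem
        have h₅ : ∀ j, j ∈ pts n → y.partner j ≠ j := fun j => y.partner_ne
        have h₆ : ∀ j, j ∉ pts n → y.partner j = j := fun j => y.partner_of_notMem
        have h₇ : (n + 1 : ℤ) ≠ -(n + 1) := by omega
        have hj := j.2
        grind }

theorem proj_insert {n : ℕ} (y : Pairing n) (c : Code n) : (y.insert c).proj = y := by
  rcases c with _ | j
  · exact proj_extend y
  · have h₁ : (n + 1 : ℤ) ∉ pts n := by simp [mem_pts]
    have h₂ : (-(n + 1) : ℤ) ∉ pts n := by simp [mem_pts]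
    have h₃ := y.partner_partner
    have h₄ : ∀ j, j ∈ pts n → y.partner j ∈ pts n := fun j => y.partner_mem
    have h₅ : ∀ j, j ∈ pts n → y.partner j ≠ j := fun j => y.partner_ne
    have h₆ : ∀ j, j ∉ pts n → y.partner j = j := fun j => y.partner_of_notMem
    have h₇ : (n + 1 : ℤ) ≠ -(n + 1) := by omega
    have hj := j.2
    ext i
    simp only [proj, insert]
    grind

theorem code_insert {n : ℕ} (y : Pairing n) (c : Code n) : (y.insert c).code = c := by
  rcases c with _ | j
  · have h₂ : (-(n + 1) : ℤ) ∉ pts n := by simp [mem_pts]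
    have : (y.insert none).partner (n + 1) = -(n + 1) := by simp [insert, extend]
    rw [code, dif_neg (by rwa [this])]
  · have : (y.insert (some j)).partner (n + 1) = j := by simp [insert]
    rw [code, dif_pos (by rw [this]; exact j.2)]
    exact congrArg some (Subtype.ext this)

theorem insert_proj_code {n : ℕ} (x : Pairing (n + 1)) : x.proj.insert x.code = x := by
  have h₀ : ∀ j, j ∈ pts (n + 1) ↔ j ∈ pts n ∨ j = n + 1 ∨ j = -(n + 1) := by
    intro j; simp only [mem_pts, Nat.cast_add, Nat.cast_one]; omega
  have h₁ : (n + 1 : ℤ) ∉ pts n := by simp [mem_pts]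
  have h₂ : (-(n + 1) : ℤ) ∉ pts n := by simp [mem_pts]
  have h₃ := x.partner_partner
  have h₄ : ∀ j, j ∈ pts (n + 1) → x.partner j ∈ pts (n + 1) := fun j => x.partner_mem
  have h₅ : ∀ j, j ∈ pts (n + 1) → x.partner j ≠ j := fun j => x.partner_ne
  have h₆ : ∀ j, j ∉ pts (n + 1) → x.partner j = j := fun j => x.partner_of_notMem
  have h₇ : (n + 1 : ℤ) ≠ -(n + 1) := by omega
  ext i
  by_cases h : x.partner (n + 1) ∈ pts n
  · rw [code, dif_pos h]
    simp only [insert, proj]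
    grind
  · rw [code, dif_neg h]
    simp only [insert, extend, proj]
    grind

theorem code_eq_none_iff {n : ℕ} (x : Pairing (n + 1)) :
    x.code = none ↔ x.partner (n + 1) = -(n + 1) := by
  have h₀ : ∀ j, j ∈ pts (n + 1) ↔ j ∈ pts n ∨ j = n + 1 ∨ j = -(n + 1) := by
    intro j; simp only [mem_pts, Nat.cast_add, Nat.cast_one]; omega
  have h₂ : (-(n + 1) : ℤ) ∉ pts n := by simp [mem_pts]
  have h₄ := x.partner_mem ((h₀ (n + 1)).2 (by simp))
  have h₅ := x.partner_ne ((h₀ (n + 1)).2 (by simp))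
  rw [code]
  by_cases h : x.partner (n + 1) ∈ pts n
  · rw [dif_pos h]
    constructor
    · intro k; cases k
    · intro k; rw [k] at h; exact absurd h h₂
  · rw [dif_neg h]
    grind

theorem card_pts (n : ℕ) : (pts n).card = 2 * n := by
  rw [pts, Finset.card_erase_of_mem (by simp), Int.card_Icc]
  omega

/-- The weights of the positions in a fibre. -/
def codeWeight (t : ℝ) (n : ℕ) (c : Code n) : ℝ := (if c = none then t else 1) / (t + 2 * n)

theorem sum_codeWeight {t : ℝ} (ht : 0 < t) (n : ℕ) :
    ∑ c, ENNReal.ofReal (codeWeight t n c) = 1 := by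
  have h0 : ∀ c : Code n, 0 ≤ codeWeight t n c := by
    intro c; unfold codeWeight; split_ifs <;> positivity
  rw [← ENNReal.ofReal_sum_of_nonneg fun c _ => h0 c]
  have : ∑ c : Code n, codeWeight t n c = 1 := by
    have h := Fintype.sum_option (fun c : Option (pts n) => codeWeight t n c)
    refine h.trans ?_
    have h₁ : codeWeight t n none = t / (t + 2 * n) := by simp [codeWeight]
    have h₂ : ∀ i : pts n, codeWeight t n (some i) = 1 / (t + 2 * n) := by
      intro i
      have : (some i : Code n) ≠ none := Option.some_ne_none i
      simp [codeWeight, this]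
    simp only [h₁, h₂, Finset.sum_const, Finset.card_univ, Fintype.card_coe, card_pts]
    have h₃ : t + 2 * n ≠ 0 := by positivity
    rw [nsmul_eq_mul]
    push_cast
    field_simp
  rw [this, ENNReal.ofReal_one]

/-- The probability distribution on the positions in a fibre. -/
def codeMeasure {t : ℝ} (ht : 0 < t) (n : ℕ) : Measure (Code n) :=
  (PMF.ofFintype (fun c => ENNReal.ofReal (codeWeight t n c)) (sum_codeWeight ht n)).toMeasure

instance {t : ℝ} (ht : 0 < t) (n : ℕ) : IsProbabilityMeasure (codeMeasure ht n) :=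
  PMF.toMeasure.isProbabilityMeasure _

theorem codeMeasure_singleton {t : ℝ} (ht : 0 < t) (n : ℕ) (c : Code n) :
    codeMeasure ht n {c} = ENNReal.ofReal (codeWeight t n c) := by
  rw [codeMeasure, PMF.toMeasure_apply_singleton _ _ (measurableSet_singleton c),
    PMF.ofFintype_apply]

/-- The sequence of pairings with the given positions in the fibres. -/
def ofCodes (c : ∀ n, Code n) : ∀ n, Pairing n
  | 0 => empty
  | n + 1 => (ofCodes c n).insert (c n)

theorem ofCodes_event {t : ℝ} (ht : 0 < t) (n : ℕ) (y : Pairing n) :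
    ∃ e : ∀ k, Code k,
      {c | ofCodes c n = y} = Set.pi (Finset.range n : Set ℕ) (fun k => {e k}) ∧
      ∏ k ∈ Finset.range n, ENNReal.ofReal (codeWeight t k (e k)) = ewens t n {y} := by
  induction n with
  | zero =>
    refine ⟨fun _ => none, ?_, ?_⟩
    · ext c; simp [Subsingleton.elim (ofCodes c 0) y]
    · simp [ewens_singleton, cycles_zero]
  | succ n ih =>
    obtain ⟨e, he, hp⟩ := ih y.proj
    refine ⟨Function.update e n y.code, ?_, ?_⟩
    · ext c
      have h₁ : ofCodes c (n + 1) = y ↔ ofCodes c n = y.proj ∧ c n = y.code := by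
        constructor
        · intro h
          rw [← h]
          exact ⟨(proj_insert _ _).symm, (code_insert _ _).symm⟩
        · rintro ⟨h, h'⟩
          rw [ofCodes, h, h', insert_proj_code]
      have h₂ := Set.ext_iff.1 he c
      simp only [Set.mem_ofPred_eq, Set.mem_pi, Finset.mem_coe, Finset.mem_range,
        Set.mem_singleton_iff] at h₂ ⊢
      rw [h₁, h₂]
      constructor
      · rintro ⟨h, h'⟩ k hk
        rcases eq_or_ne k n with rfl | hkn
        · rw [h', Function.update_self]
        · rw [Function.update_of_ne hkn]; exact h k (by omega)
      · intro h
        refine ⟨fun k hk => ?_, ?_⟩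
        · have := h k (by omega)
          rwa [Function.update_of_ne hk.ne] at this
        · have := h n (by omega)
          rwa [Function.update_self] at this
    · rw [Finset.prod_range_succ, Function.update_self]
      have h₁ : ∏ k ∈ Finset.range n,
          ENNReal.ofReal (codeWeight t k (Function.update e n y.code k)) = ewens t n {y.proj} := by
        rw [← hp]
        refine Finset.prod_congr rfl fun k hk => ?_
        rw [Function.update_of_ne (Finset.mem_range.1 hk).ne]
      rw [h₁, ewens_singleton, ewens_singleton, ← ENNReal.ofReal_mul (by positivity)]
      congr 1
      rw [Finset.prod_range_succ, cycles_proj y, codeWeight]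
      simp only [code_eq_none_iff]
      split_ifs
      · rw [pow_succ]; field_simp
      · rw [add_zero]; field_simp

end Pairing

namespace PairingLimit

open Pairing

/-- The measures `μ_t^{(n)}` are probability measures, compatible with the canonical projections,
so that their projective limit exists. -/
theorem exists_mu {t : ℝ} (ht : 0 < t) :
    ∃ μ : Measure PairingLimit, IsProbabilityMeasure μ ∧ ∀ n, μ.map (coord n) = ewens t n := by
  let Φ : (∀ n, Code n) → PairingLimit := fun c => ⟨ofCodes c, fun n => proj_insert _ _⟩
  have hcoord : ∀ n, Measurable fun c => (Φ c).coord n := by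
    intro n
    refine measurable_to_countable' fun y => ?_
    obtain ⟨e, he, -⟩ := ofCodes_event ht n y
    have : (fun c => (Φ c).coord n) ⁻¹' {y} = {c | ofCodes c n = y} := rfl
    rw [this, he]
    exact MeasurableSet.pi (Finset.range n).countable_toSet fun k _ => measurableSet_singleton _
  have hΦ : Measurable Φ := measurable_of_coord hcoord
  refine ⟨(Measure.infinitePi fun n => codeMeasure ht n).map Φ,
    Measure.isProbabilityMeasure_map hΦ.aemeasurable, fun n => ?_⟩
  rw [Measure.map_map (measurable_coord n) hΦ]
  refine Measure.ext_iff_singleton.2 fun y => ?_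
  rw [Measure.map_apply (f := coord n ∘ Φ) (hcoord n) (measurableSet_singleton y)]
  obtain ⟨e, he, hp⟩ := ofCodes_event ht n y
  have : (coord n ∘ Φ) ⁻¹' {y} = {c | ofCodes c n = y} := rfl
  rw [this, he, Measure.infinitePi_pi _ fun k _ => measurableSet_singleton _, ← hp]
  simp only [codeMeasure_singleton]

/-- The measure `μ_t` on `X`: the projective limit of the measures `μ_t^{(n)}`, that is, the
probability measure whose image under every `p_n` is `μ_t^{(n)}` (it is unique by `measure_ext`). -/
def mu {t : ℝ} (ht : 0 < t) : Measure PairingLimit := Classical.choose (exists_mu ht)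

instance {t : ℝ} (ht : 0 < t) : IsProbabilityMeasure (mu ht) :=
  (Classical.choose_spec (exists_mu ht)).1

theorem map_coord_mu {t : ℝ} (ht : 0 < t) (n : ℕ) : (mu ht).map (coord n) = ewens t n :=
  (Classical.choose_spec (exists_mu ht)).2 n

/-- A finite measure on `X` is determined by its images on the spaces `X(n)`, for large `n`. -/
theorem measure_ext {μ ν : Measure PairingLimit} [IsFiniteMeasure μ] (N : ℕ)
    (h : ∀ n, N ≤ n → μ.map (coord n) = ν.map (coord n)) : μ = ν := by
  let C : Set (Set PairingLimit) :=
    {A | ∃ (n : ℕ) (_ : N ≤ n) (S : Set (Pairing n)), A = coord n ⁻¹' S}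
  have hdown : ∀ {m n : ℕ} (hmn : n ≤ m) (S : Set (Pairing n)),
      coord n ⁻¹' S = coord m ⁻¹' (down hmn ⁻¹' S) := by
    intro m n hmn S
    ext x
    simp only [Set.mem_preimage, down_coord]
  refine ext_of_generate_finite C ?_ ?_ ?_ ?_
  · refine le_antisymm ?_ (MeasurableSpace.generateFrom_le ?_)
    · have : @Measurable _ _ (MeasurableSpace.generateFrom C) _ (id : PairingLimit → _) := by
        refine @measurable_of_coord _ (MeasurableSpace.generateFrom C) _ fun n => ?_
        intro S _
        refine MeasurableSpace.measurableSet_generateFrom ?_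
        exact ⟨max n N, le_max_right _ _, down (le_max_left n N) ⁻¹' S, hdown _ S⟩
      exact fun A hA => this hA
    · rintro _ ⟨n, -, S, rfl⟩
      exact measurable_coord n S.toFinite.measurableSet
  · rintro _ ⟨m, hm, S, rfl⟩ _ ⟨n, hn, S', rfl⟩ -
    refine ⟨max m n, hm.trans (le_max_left _ _), down (le_max_left m n) ⁻¹' S ∩
      down (le_max_right m n) ⁻¹' S', ?_⟩
    rw [hdown (le_max_left m n), hdown (le_max_right m n) S', Set.preimage_inter]
  · rintro _ ⟨n, hn, S, rfl⟩
    have hS := S.toFinite.measurableSet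
    rw [← Measure.map_apply (measurable_coord n) hS, h n hn,
      Measure.map_apply (measurable_coord n) hS]
  · have := congrArg (fun ρ : Measure (Pairing N) => ρ Set.univ) (h N le_rfl)
    simpa [Measure.map_apply (measurable_coord N) MeasurableSet.univ] using this

end PairingLimit

theorem sq_norm_pos {z : ℂ} (hz : z ≠ 0) : 0 < ‖z‖ ^ 2 := by positivity

theorem Pairing.act_bijective {n : ℕ} (g : S2 n) :
    Function.Bijective fun x : Pairing n => x.act g := by
  refine Function.bijective_iff_has_inverse.2 ⟨fun x => x.act g⁻¹, fun x => ?_, fun x => ?_⟩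
  · change (x.act g).act g⁻¹ = x
    rw [← act_mul, mul_inv_cancel, act_one]
  · change (x.act g⁻¹).act g = x
    rw [← act_mul, inv_mul_cancel, act_one]

theorem Pairing.map_count_withDensity {n : ℕ} (g : S2 n) (w : Pairing n → ℝ≥0∞) :
    (Measure.count.withDensity fun x : Pairing n => w (x.act g)).map (fun x => x.act g)
      = Measure.count.withDensity w := by
  refine Measure.ext_iff_singleton.2 fun y => ?_
  obtain ⟨x, rfl⟩ := (act_bijective g).2 y
  rw [Measure.map_apply (measurable_of_finite _) (measurableSet_singleton _)]
  have : (fun x : Pairing n => x.act g) ⁻¹' {x.act g} = {x} := by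
    ext x'; exact (act_bijective g).1.eq_iff
  simp only [this, count_withDensity_singleton]

/-- Quasi-invariance of the measure `μ_t`, `t = |z|²`: `dμ_t(x · g) = t ^ c(x; g) dμ_t(x)`. -/
theorem PairingLimit.quasiinvariant {z : ℂ} (hz : z ≠ 0) (g : S2inf) :
    ((mu (sq_norm_pos hz)).withDensity fun x => ‖z ^ x.cocycle g‖ₑ ^ 2).map (fun x => x.act g)
      = mu (sq_norm_pos hz) := by
  refine (measure_ext (level g) fun n hn => ?_).symm
  have hg := S2_mono hn (mem_level g)
  have hz' : 0 < ‖z‖ ^ 2 := sq_norm_pos hz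
  let d : Pairing n → ℝ≥0∞ := fun y => ‖z ^ (((y.act ⟨g, hg⟩).cycles : ℤ) - y.cycles)‖ₑ ^ 2
  have hd : (fun x : PairingLimit => ‖z ^ x.cocycle g‖ₑ ^ 2) = fun x => d (x.coord n) := by
    ext1 x; simp only [d, cocycle_eq x g n hg]
  have hmap : ((mu (sq_norm_pos hz)).withDensity fun x => d (x.coord n)).map (coord n)
      = (Pairing.ewens (‖z‖ ^ 2) n).withDensity d := by
    ext S hS
    rw [Measure.map_apply (measurable_coord n) hS, withDensity_apply _ (measurable_coord n hS),
      withDensity_apply _ hS, ← map_coord_mu (sq_norm_pos hz) n,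
      setLIntegral_map hS (measurable_of_finite _) (measurable_coord n)]
  rw [Measure.map_map (measurable_coord n) (measurable_act g), map_coord_mu, hd]
  have hcomp : (coord n ∘ fun x => act x g) = (fun y => Pairing.act y ⟨g, hg⟩) ∘ coord n := by
    ext1 x; exact coord_act x g n hg
  rw [hcomp, ← Measure.map_map (measurable_of_finite _) (measurable_coord n), hmap]
  rw [Pairing.ewens, ← withDensity_mul _ (measurable_of_finite _) (measurable_of_finite _)]
  rw [← Pairing.map_count_withDensity ⟨g, hg⟩]
  congr 2
  ext1 y
  simp only [Pi.mul_apply, d]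
  have h₁ : ∀ k : ℤ, ‖z ^ k‖ₑ ^ 2 = ENNReal.ofReal ((‖z‖ ^ 2) ^ k) := by
    intro k
    rw [← ofReal_norm, ← ENNReal.ofReal_pow (norm_nonneg _), norm_zpow, ← zpow_natCast,
      ← zpow_natCast, ← zpow_mul, ← zpow_mul, mul_comm]
  rw [h₁, ← ENNReal.ofReal_mul (by positivity)]
  congr 1
  rw [zpow_sub₀ hz'.ne', zpow_natCast, zpow_natCast]
  field_simp

theorem isCocycle_zpow {z : ℂ} (hz : z ≠ 0) :
    IsCocycle (PairingLimit.mu (sq_norm_pos hz)) PairingLimit.act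
      (fun x (g : S2inf) => z ^ x.cocycle g) where
  act_one := PairingLimit.act_one
  act_mul := PairingLimit.act_mul
  measurable_act := PairingLimit.measurable_act
  measurable_cocycle g := by
    have : (fun x : PairingLimit => z ^ x.cocycle g)
        = (fun y : Pairing (level g) => z ^ (((y.act ⟨g, mem_level g⟩).cycles : ℤ) - y.cycles)) ∘
          PairingLimit.coord (level g) := rfl
    rw [this]
    exact (measurable_of_finite _).comp (PairingLimit.measurable_coord _)
  cocycle_ne_zero x g := zpow_ne_zero _ hz
  cocycle_mul x g₁ g₂ := by rw [PairingLimit.cocycle_mul, zpow_add₀ hz]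
  map_eq := PairingLimit.quasiinvariant hz

/-- The representation `T_{z,1/2}` of `S(2∞)` in the Hilbert space `L²(X, μ_t)`, `t = |z|²`:
`(T_{z,1/2}(g) f)(x) = z ^ c(x; g) f(x · g)`. -/
def Tz {z : ℂ} (hz : z ≠ 0) : UnitaryRep S2inf (Lp ℂ 2 (PairingLimit.mu (sq_norm_pos hz))) :=
  (isCocycle_zpow hz).rep

theorem isCocycle_one (n : ℕ) :
    IsCocycle (Pairing.haar n) Pairing.act (fun _ (_ : S2 n) => 1) where
  act_one := Pairing.act_one
  act_mul := Pairing.act_mul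
  measurable_act _ := measurable_of_finite _
  measurable_cocycle _ := measurable_const
  cocycle_ne_zero _ _ := one_ne_zero
  cocycle_mul _ _ _ := (one_mul 1).symm
  map_eq g := by
    have h := Pairing.map_count_withDensity g (fun _ => 1)
    have h₁ : (fun _ : Pairing n => ‖(1 : ℂ)‖ₑ ^ 2) = 1 := by ext1; simp
    have h₂ : (fun _ : Pairing n => (1 : ℝ≥0∞)) = 1 := rfl
    rw [h₂, withDensity_one] at h
    rw [h₁, withDensity_one, Pairing.haar, Measure.map_smul, h]

/-- The Hilbert space `L²(X(n), μ_1^{(n)})`. -/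
abbrev L2 (n : ℕ) : Type := Lp ℂ 2 (Pairing.haar n)

/-- The representation `Reg^n` of `S(2n)` in `L²(X(n), μ_1^{(n)})`: `(Reg^n(g) f)(x) = f(x · g)`. -/
def Reg (n : ℕ) : UnitaryRep (S2 n) (L2 n) := (isCocycle_one n).rep

instance : Nonempty (Pairing 0) := ⟨Pairing.empty⟩

theorem Pairing.nonempty (n : ℕ) : Nonempty (Pairing n) := by
  induction n with
  | zero => infer_instance
  | succ n ih => exact ih.map extend

theorem Pairing.ae_haar {n : ℕ} {p : Pairing n → Prop} : (∀ᵐ x ∂haar n, p x) ↔ ∀ x, p x := by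
  have := Measure.ae_ennreal_smul_measure_iff (μ := (Measure.count : Measure (Pairing n))) (p := p)
    (ENNReal.inv_ne_zero.2 (ENNReal.natCast_ne_top (Nat.card (Pairing n))))
  rwa [Measure.ae_count_iff] at this

instance (n : ℕ) : IsFiniteMeasure (Pairing.haar n) := by
  have := Pairing.nonempty n
  refine ⟨?_⟩
  rw [Pairing.haar, Measure.smul_apply, smul_eq_mul]
  exact ENNReal.mul_lt_top (by simp) (measure_lt_top _ _)

open Classical in
/-- The formula for `L_z^{(n)} f`, with `t = |z|²`: its value at `x` is
`z √((2n+1)/(2n+t)) f(x)` if `x ∈ X(n) ⊆ X(n+1)`, and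
`√((2n+1)/(2n+t)) f(p_{n,n+1}(x))` if `x ∈ X(n+1) ∖ X(n)`. In the first case, `x` is obtained from
an element of `X(n)` by adding the pair `{-n-1, n+1}`, and this element is `x.proj`
(see `Pairing.proj_extend`). -/
def LzFun (z : ℂ) (n : ℕ) (f : Pairing n → ℂ) (x : Pairing (n + 1)) : ℂ :=
  if x ∈ Set.range Pairing.extend then
    z * (√((2 * n + 1) / (2 * n + ‖z‖ ^ 2)) : ℝ) * f x.proj
  else (√((2 * n + 1) / (2 * n + ‖z‖ ^ 2)) : ℝ) * f x.proj

/-- The operator `L_z^{(n)} : L²(X(n), μ_1^{(n)}) → L²(X(n+1), μ_1^{(n+1)})`. -/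
def Lz (z : ℂ) (n : ℕ) : L2 n →ₗ[ℂ] L2 (n + 1) where
  toFun f := (MemLp.of_discrete : MemLp (LzFun z n f) 2 (Pairing.haar (n + 1))).toLp _
  map_add' f₁ f₂ := by
    have h := Pairing.ae_haar.1 (Lp.coeFn_add f₁ f₂)
    rw [← MemLp.toLp_add]
    congr 1
    ext1 x
    simp only [LzFun, Pi.add_apply, h]
    split_ifs <;> ring
  map_smul' c f := by
    have h := Pairing.ae_haar.1 (Lp.coeFn_smul c f)
    rw [RingHom.id_apply, ← MemLp.toLp_const_smul]
    congr 1
    ext1 x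
    simp only [LzFun, Pi.smul_apply, h, smul_eq_mul]
    split_ifs <;> ring

theorem Lz_apply (z : ℂ) (n : ℕ) (f : L2 n) (x : Pairing (n + 1)) :
    Lz z n f x = LzFun z n f x :=
  Pairing.ae_haar.1
    (MemLp.coeFn_toLp (MemLp.of_discrete : MemLp (LzFun z n f) 2 (Pairing.haar (n + 1)))) x

end

/-! Write t = |z|². The weights of μ_1^{(n)} and μ_t^{(n)} are explicit, so the density of the first
with respect to the second is a constant times t^{-[x]_n}. Choose the complex square root ρ_n(x) =
const · z^{-[x]_n} of this density (`rootDensity`) and send f in L²(X(n), μ_1^{(n)}) to the function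
V_n f(x) = ρ_n(p_n(x)) f(p_n(x)) on X. Since p_n carries μ_t to μ_t^{(n)}, V_n is an isometric
embedding in L²(X, μ_t) (`coordEmbedding`).

The phase of ρ_n is what makes everything fit together. On S(2n) the cocycle is z^{[x·g]_n - [x]_n},
the coboundary of z^{[x]_n}, so z^{c(x;g)} ρ_n(x·g) = ρ_n(x): V_n intertwines Reg^n with the
restriction of T_{z,1/2} (`coordEmbedding_Reg`). Moreover, passing from n to n+1 adds one cycle
exactly when {-n-1, n+1} is a pair of x, so the quotient of ρ_n(p_{n,n+1}(x)) by ρ_{n+1}(x) is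
precisely the factor by which L_z^{(n)} multiplies. Hence V_{n+1} L_z^{(n)} = V_n
(`coordEmbedding_Lz`).

All three claims follow. L_z^{(n)} is isometric because V_n and V_{n+1} are, and it is intertwining
because V_n and V_{n+1} are and V_{n+1} is injective. The V_n glue to an isometry of the inductive
limit into L²(X, μ_t), which respects the two representations (`rep_equivalent`). It is onto because
the range of V_n consists of all functions of the coordinate p_n(x), and such functions are dense
(`iSup_range_coordEmbedding_dense`). -/

noncomputable section

/-! ### Maps out of an inductive limit of Hilbert spaces. -/

namespace IndLim

section Lift

variable {H : ℕ → Type} [∀ n, NormedAddCommGroup (H n)] [∀ n, InnerProductSpace ℂ (H n)]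
  (α : ∀ n, H n →ₗᵢ[ℂ] H (n + 1))
  {K : Type} [NormedAddCommGroup K] [InnerProductSpace ℂ K]

/-- A compatible family of isometries of the spaces `H n` extends to their inductive limit. -/
theorem exists_lift [CompleteSpace K] (V : ∀ n, H n →ₗᵢ[ℂ] K)
    (hV : ∀ n ξ, V (n + 1) (α n ξ) = V n ξ) :
    ∃ F : Space α →ₗᵢ[ℂ] K, ∀ n ξ, F (embed α n ξ) = V n ξ := by
  -- Descending to the direct limit needs compatibility with all the composite embeddings, not only
  -- with single steps.
  have key : ∀ {m n : ℕ} (h : m ≤ n) (ξ : H m), V m ξ = V n (trans α m n h ξ) := by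
    intro m n h ξ
    induction n, h using Nat.le_induction with
    | base => rw [trans_self]
    | succ n h ih => rw [trans_succ α m n h, hV, ih]
  let F₀ : UnionSpace α → K :=
    DirectLimit.lift (fun i j h => trans α i j h) (fun n ξ => V n ξ) (fun _ _ h ξ => key h ξ)
  have hF₀ : ∀ n ξ, F₀ (incl α n ξ) = V n ξ := fun n ξ => rfl
  let F₁ : UnionSpace α →ₗᵢ[ℂ] K :=
    { toFun := F₀
      map_add' := fun x y => by
        obtain ⟨n, ξ, η, rfl, rfl⟩ := exists_incl₂ α x y
        rw [← map_add, hF₀, hF₀, hF₀, map_add]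
      map_smul' := fun c x => by
        obtain ⟨n, ξ, rfl⟩ := exists_incl α x
        rw [← map_smul, hF₀, hF₀, map_smul, RingHom.id_apply]
      norm_map' := fun x => by
        obtain ⟨n, ξ, rfl⟩ := exists_incl α x
        change ‖F₀ (incl α n ξ)‖ = _
        rw [hF₀, norm_incl, LinearIsometry.norm_map] }
  let e : UnionSpace α →L[ℂ] Space α :=
    UniformSpace.Completion.toComplL (𝕜 := ℂ) (E := UnionSpace α)
  -- The union is dense in its completion and `K` is complete, so the isometry extends by
  -- continuity.
  let F₂ : Space α →L[ℂ] K := F₁.toContinuousLinearMap.extend e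
  have hF₂ : ∀ x : UnionSpace α, F₂ (e x) = F₁ x := fun x =>
    F₁.toContinuousLinearMap.extend_eq UniformSpace.Completion.denseRange_coe
      (UniformSpace.Completion.isUniformInducing_coe _) x
  refine ⟨⟨F₂.toLinearMap, fun x => ?_⟩, fun n ξ => hF₂ (incl α n ξ)⟩
  refine UniformSpace.Completion.induction_on x ?_ fun y => ?_
  · exact isClosed_eq F₂.continuous.norm continuous_norm
  · change ‖F₂ (e y)‖ = _
    rw [hF₂, F₁.norm_map]
    exact (UniformSpace.Completion.norm_coe y).symm

/-- The inductive limit of unitary representations is equivalent to any unitary representation in a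
Hilbert space that is the closure of a compatible increasing union of copies of them. -/
theorem rep_equivalent [CompleteSpace K] {Γ : Type} [Group Γ] {G : ℕ → Subgroup Γ}
    (hG : Monotone G) (T : ∀ n, UnitaryRep (G n) (H n))
    (hT : ∀ (n : ℕ) (g : G n) (ξ : H n),
      α n (T n g ξ) = T (n + 1) (Subgroup.inclusion (hG n.le_succ) g) (α n ξ))
    (S : UnitaryRep (⨆ n, G n : Subgroup Γ) K) (V : ∀ n, H n →ₗᵢ[ℂ] K)
    (hV : ∀ n ξ, V (n + 1) (α n ξ) = V n ξ)
    (hS : ∀ (n : ℕ) (g : (⨆ n, G n : Subgroup Γ)) (h : (g : Γ) ∈ G n) (ξ : H n),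
      V n (T n ⟨g, h⟩ ξ) = S g (V n ξ))
    (hd : (⨆ n, (V n).toLinearMap.range).topologicalClosure = ⊤) :
    UnitaryRep.Equivalent (rep α hG T hT) S := by
  obtain ⟨F, hF⟩ := exists_lift α V hV
  -- The range of an isometry of a complete space is closed, and it contains the range of every `V
  -- n`; by `hd` it is everything.
  have hsurj : Function.Surjective F := by
    have hle : (⨆ n, (V n).toLinearMap.range) ≤ F.toLinearMap.range := by
      refine iSup_le fun n => ?_
      rintro _ ⟨ξ, rfl⟩
      exact ⟨embed α n ξ, hF n ξ⟩
    have hcl : IsClosed (F.toLinearMap.range : Set K) :=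
      F.isometry.isClosedEmbedding.isClosed_range
    have := Submodule.topologicalClosure_minimal _ hle hcl
    rw [hd, top_le_iff] at this
    exact LinearMap.range_eq_top.1 this
  refine ⟨LinearIsometryEquiv.ofSurjective F hsurj, fun g x => ?_⟩
  change F (rep α hG T hT g x) = S g (F x)
  refine congrFun (Continuous.ext_on (dense_embed α)
    (F.continuous.comp (rep α hG T hT g).continuous)
    ((S g).continuous.comp F.continuous) ?_) x
  rintro _ ⟨n, ξ, rfl⟩
  -- By continuity the check is needed only on vectors from a finite stage `n`. Since `g` need not
  -- belong to `G n`, the vector is moved to a later stage whose group contains `g`.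
  obtain ⟨N, hN⟩ := exists_stage hG g
  have hm : (g : Γ) ∈ G (max n N) := hG (le_max_right n N) hN
  simp only [Function.comp_apply]
  rw [← embed_trans α (le_max_left n N) ξ, rep_embed α hG T hT g _ hm, hF, hF, hS]

end Lift

end IndLim

/-! ### The density of the uniform measure with respect to μ_t^{(n)}. -/

namespace Pairing

variable {n : ℕ}

/-- For t = 1 the weights are constant, and the total mass 1 then forces the constant to be the
inverse of the number of pairings. No separate count of the pairings is needed: the total mass is
known because the measure is the image of a probability measure on X. -/
theorem ewens_one (n : ℕ) : ewens 1 n = haar n := by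
  have hconst : ewens 1 n
      = ENNReal.ofReal (1 / ∏ k ∈ Finset.range n, ((1 : ℝ) + 2 * k)) • Measure.count := by
    rw [ewens]
    simp only [one_pow]
    exact withDensity_const _
  have huniv : ewens 1 n Set.univ = 1 := by
    rw [← PairingLimit.map_coord_mu one_pos n,
      Measure.map_apply (PairingLimit.measurable_coord n) MeasurableSet.univ, Set.preimage_univ,
      measure_univ]
  rw [hconst, Measure.smul_apply, smul_eq_mul, Measure.count_univ] at huniv
  rw [hconst, haar, ENNReal.eq_inv_of_mul_eq_one_left huniv, ENat.card_eq_coe_natCard]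
  rfl

/-- The square root of the density of the uniform measure on `X(n)` with respect to the measure
`μ_t^{(n)}`, `t = |z|²`, with the argument of `z ^ (-[x]_n)`. -/
def rootDensity (z : ℂ) (x : Pairing n) : ℂ :=
  (√(∏ k ∈ Finset.range n, (‖z‖ ^ 2 + 2 * k) / (2 * k + 1)) : ℝ) * (z ^ x.cycles)⁻¹

theorem rootDensity_ne_zero {z : ℂ} (hz : z ≠ 0) (x : Pairing n) : rootDensity z x ≠ 0 := by
  have hz' := sq_norm_pos hz
  refine mul_ne_zero ?_ (inv_ne_zero (pow_ne_zero _ hz))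
  rw [Complex.ofReal_ne_zero]
  exact (Real.sqrt_pos.2 (Finset.prod_pos fun k _ => by positivity)).ne'

/-- Taking |·|² removes the phase and leaves ∏(t+2k)/(2k+1) · t^{-[x]_n}, which is the quotient of
the weights for parameters 1 and t. -/
theorem ewens_withDensity_rootDensity {z : ℂ} (hz : z ≠ 0) (n : ℕ) :
    (ewens (‖z‖ ^ 2) n).withDensity (fun x => ‖rootDensity z x‖ₑ ^ 2) = haar n := by
  have hz' := sq_norm_pos hz
  rw [← ewens_one, ewens, ewens,
    ← withDensity_mul _ (measurable_of_finite _) (measurable_of_finite _)]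
  congr 1
  ext1 x
  have hP : 0 < ∏ k ∈ Finset.range n, (‖z‖ ^ 2 + 2 * (k : ℝ)) :=
    Finset.prod_pos fun k _ => by positivity
  have hQ : 0 < ∏ k ∈ Finset.range n, (1 + 2 * (k : ℝ)) :=
    Finset.prod_pos fun k _ => by positivity
  have hsq : ‖rootDensity z x‖ ^ 2 = (∏ k ∈ Finset.range n, (‖z‖ ^ 2 + 2 * (k : ℝ))) /
      (∏ k ∈ Finset.range n, (1 + 2 * (k : ℝ))) * ((‖z‖ ^ 2) ^ x.cycles)⁻¹ := by
    rw [rootDensity, norm_mul, mul_pow, Complex.norm_real, Real.norm_eq_abs, sq_abs, Real.sq_sqrt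
      (Finset.prod_nonneg fun k _ => by positivity), Finset.prod_div_distrib, norm_inv, norm_pow,
      inv_pow, ← pow_mul, ← pow_mul, mul_comm x.cycles]
    simp only [add_comm (1 : ℝ)]
  rw [Pi.mul_apply, ← ofReal_norm, ← ENNReal.ofReal_pow (norm_nonneg _),
    ← ENNReal.ofReal_mul (by positivity), hsq, one_pow]
  congr 1
  field_simp

/-- If `{-n-1, n+1}` is a pair of `x`, then `x` belongs to `X(n) ⊆ X(n+1)`, and conversely. -/
theorem mem_range_extend_iff (x : Pairing (n + 1)) :
    x ∈ Set.range extend ↔ x.partner (n + 1) = -(n + 1) := by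
  rw [← code_eq_none_iff]
  constructor
  · rintro ⟨y, rfl⟩
    exact code_insert y none
  · intro h
    refine ⟨x.proj, ?_⟩
    have := insert_proj_code x
    rwa [h] at this

/-- This explains the coefficients of L_z^{(n)}: the square root cancels the new factor of the
normalizing product, and the extra z on X(n) cancels the z⁻¹ coming from the additional cycle {-n-1,
n+1}. -/
theorem rootDensity_mul_LzFun {z : ℂ} (hz : z ≠ 0) (f : Pairing n → ℂ) (x : Pairing (n + 1)) :
    rootDensity z x * LzFun z n f x = rootDensity z x.proj * f x.proj := by
  have hz' := sq_norm_pos hz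
  -- The factor with `k = n` in the product is the inverse of the number under the second root.
  have hsqrt : ((√(∏ k ∈ Finset.range (n + 1), (‖z‖ ^ 2 + 2 * k) / (2 * k + 1)) : ℝ) : ℂ)
      * (√((2 * n + 1) / (2 * n + ‖z‖ ^ 2)) : ℝ)
      = (√(∏ k ∈ Finset.range n, (‖z‖ ^ 2 + 2 * k) / (2 * k + 1)) : ℝ) := by
    rw [← Complex.ofReal_mul, ← Real.sqrt_mul (Finset.prod_nonneg fun k _ => by positivity),
      Finset.prod_range_succ, mul_assoc, add_comm (2 * (n : ℝ)) (‖z‖ ^ 2),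
      div_mul_div_cancel₀ (by positivity), div_self (by positivity), mul_one]
  rw [rootDensity, rootDensity, ← hsqrt, LzFun, cycles_proj x]
  simp only [mem_range_extend_iff]
  split_ifs
  · rw [pow_succ]
    field_simp
    ring
  · rw [add_zero]
    ring

end Pairing

/-! ### Cylinder sets in X. -/

namespace PairingLimit

theorem measurePreserving_coord {t : ℝ} (ht : 0 < t) (n : ℕ) :
    MeasurePreserving (coord n) (mu ht) (Pairing.ewens t n) :=
  ⟨measurable_coord n, map_coord_mu ht n⟩

/-- The sets that are determined by one of the coordinates `p_n(x)`, `n ≥ 1`. -/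
def cylinders : Set (Set PairingLimit) :=
  {A | ∃ (n : ℕ) (S : Set (Pairing (n + 1))), A = coord (n + 1) ⁻¹' S}

theorem coord_preimage {m n : ℕ} (h : n ≤ m) (S : Set (Pairing n)) :
    coord n ⁻¹' S = coord m ⁻¹' (down h ⁻¹' S) := by
  ext x
  simp only [Set.mem_preimage, down_coord]

theorem isSetAlgebra_cylinders : IsSetAlgebra cylinders where
  empty_mem := ⟨0, ∅, rfl⟩
  compl_mem := by
    rintro _ ⟨n, S, rfl⟩
    exact ⟨n, Sᶜ, rfl⟩
  union_mem := by
    rintro _ _ ⟨m, S, rfl⟩ ⟨n, S', rfl⟩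
    have hm : m + 1 ≤ max m n + 1 := by omega
    have hn : n + 1 ≤ max m n + 1 := by omega
    refine ⟨max m n, down hm ⁻¹' S ∪ down hn ⁻¹' S', ?_⟩
    rw [coord_preimage hm, coord_preimage hn, Set.preimage_union]

theorem generateFrom_cylinders :
    (inferInstance : MeasurableSpace PairingLimit) = MeasurableSpace.generateFrom cylinders := by
  refine le_antisymm ?_ (MeasurableSpace.generateFrom_le ?_)
  · have : @Measurable _ _ (MeasurableSpace.generateFrom cylinders) _
        (id : PairingLimit → PairingLimit) := by
      refine @measurable_of_coord _ (MeasurableSpace.generateFrom cylinders) _ fun n S _ => ?_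
      -- Cylinders use only coordinates of positive index, so a set given by coordinate `n`,
      -- possibly `0`, is rewritten by coordinate `n + 1`.
      exact MeasurableSpace.measurableSet_generateFrom ⟨n, _, coord_preimage n.le_succ S⟩
    exact fun A hA => this hA
  · rintro _ ⟨n, S, rfl⟩
    exact measurable_coord _ S.toFinite.measurableSet

/-- A set algebra that generates the σ-algebra approximates every measurable set in a finite
measure. This is the source of the density of functions of finitely many coordinates. -/
theorem measureDense_cylinders {t : ℝ} (ht : 0 < t) : (mu ht).MeasureDense cylinders :=
  .of_generateFrom_isSetAlgebra_finite _ isSetAlgebra_cylinders generateFrom_cylinders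

/-! ### The embeddings V_n of L²(X(n), μ_1^{(n)}) in L²(X, μ_t). -/

section CoordEmbedding

variable {z : ℂ} (hz : z ≠ 0) (n : ℕ)

/-- The integral over X is pushed to X(n) along p_n, where |ρ_n|² turns μ_t^{(n)} into the uniform
measure. -/
theorem eLpNorm_rootDensity_mul (f : Pairing n → ℂ) :
    eLpNorm (fun x : PairingLimit => (x.coord n).rootDensity z * f (x.coord n)) 2
      (mu (sq_norm_pos hz)) = eLpNorm f 2 (Pairing.haar n) := by
  have h := eLpNorm_comp_measurePreserving (p := 2)
    (g := fun y : Pairing n => y.rootDensity z * f y)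
    (measurable_of_finite _).aestronglyMeasurable (measurePreserving_coord (sq_norm_pos hz) n)
  refine h.trans ?_
  rw [eLpNorm_eq_lintegral_rpow_enorm_toReal (by norm_num) (by norm_num),
    eLpNorm_eq_lintegral_rpow_enorm_toReal (by norm_num) (by norm_num)]
  congr 1
  simp only [ENNReal.toReal_ofNat, ENNReal.rpow_ofNat, enorm_mul, mul_pow]
  rw [← Pairing.ewens_withDensity_rootDensity hz,
    lintegral_withDensity_eq_lintegral_mul _ (measurable_of_finite _) (measurable_of_finite _)]
  rfl

theorem memLp_rootDensity_mul (f : Pairing n → ℂ) :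
    MemLp (fun x : PairingLimit => (x.coord n).rootDensity z * f (x.coord n)) 2
      (mu (sq_norm_pos hz)) := by
  refine ⟨((measurable_of_finite fun y : Pairing n => y.rootDensity z * f y).comp
    (measurable_coord n)).aestronglyMeasurable, ?_⟩
  rw [eLpNorm_rootDensity_mul hz]
  exact (MemLp.of_discrete : MemLp f 2 (Pairing.haar n)).2

/-- The isometric embedding `L²(X(n), μ_1^{(n)}) → L²(X, μ_t)`, `t = |z|²`, given by the composition
with `p_n` and the multiplication by the square root of the density. -/
def coordEmbedding : L2 n →ₗᵢ[ℂ] Lp ℂ 2 (mu (sq_norm_pos hz)) where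
  toFun f := (memLp_rootDensity_mul hz n f).toLp _
  map_add' f₁ f₂ := by
    -- Every point of X(n) has positive mass, so the almost everywhere identity holds at every point
    -- and may be evaluated at p_n(x).
    have h := Pairing.ae_haar.1 (Lp.coeFn_add f₁ f₂)
    rw [← MemLp.toLp_add]
    congr 1
    ext1 x
    simp only [Pi.add_apply, h]
    ring
  map_smul' c f := by
    have h := Pairing.ae_haar.1 (Lp.coeFn_smul c f)
    rw [RingHom.id_apply, ← MemLp.toLp_const_smul]
    congr 1
    ext1 x
    simp only [Pi.smul_apply, h, smul_eq_mul]
    ring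
  norm_map' f := by
    change ‖(memLp_rootDensity_mul hz n f).toLp _‖ = _
    rw [Lp.norm_toLp, eLpNorm_rootDensity_mul hz, Lp.norm_def]

theorem coeFn_coordEmbedding (f : L2 n) :
    coordEmbedding hz n f =ᵐ[mu (sq_norm_pos hz)]
      fun x => (x.coord n).rootDensity z * f (x.coord n) :=
  (memLp_rootDensity_mul hz n f).coeFn_toLp

theorem coordEmbedding_Lz (f : L2 n) :
    coordEmbedding hz (n + 1) (Lz z n f) = coordEmbedding hz n f := by
  refine Lp.ext ?_
  filter_upwards [coeFn_coordEmbedding hz n f, coeFn_coordEmbedding hz (n + 1) (Lz z n f)]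
    with x h₁ h₂
  rw [h₁, h₂, Lz_apply, Pairing.rootDensity_mul_LzFun hz, proj_coord]

/-- The cocycle is trivialized by ρ_n on S(2n): the factor z^{[x·g]_n} of z^{c(x;g)} cancels the
phase of ρ_n at x·g, and what remains is ρ_n(x). -/
theorem coordEmbedding_Reg (g : S2inf) (hg : (g : (Equiv.Perm ℤ)ᵐᵒᵖ) ∈ S2 n) (f : L2 n) :
    coordEmbedding hz n (Reg n ⟨g, hg⟩ f) = Tz hz g (coordEmbedding hz n f) := by
  have hR := Pairing.ae_haar.1 ((isCocycle_one n).coeFn_rep ⟨g, hg⟩ f)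
  refine Lp.ext ?_
  -- The formula for the embedded function is also needed at the translated point x·g;
  -- quasi-invariance of μ_t makes it valid there for almost every x.
  filter_upwards [coeFn_coordEmbedding hz n (Reg n ⟨g, hg⟩ f),
    (isCocycle_zpow hz).coeFn_rep g (coordEmbedding hz n f),
    ((isCocycle_zpow hz).quasi g).ae (coeFn_coordEmbedding hz n f)] with x h₁ h₂ h₃
  rw [h₁, Tz, h₂, h₃, Reg, hR, coord_act x g n hg, cocycle_eq x g n hg, Pairing.rootDensity,
    Pairing.rootDensity, zpow_sub₀ hz, zpow_natCast, zpow_natCast]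
  have := pow_ne_zero ((x.coord n).act ⟨g, hg⟩).cycles hz
  field_simp

/-- Since ρ_n never vanishes, φ can be divided by it, and every function on the finite set X(n) is
square integrable. -/
theorem toLp_comp_coord_mem_range (φ : Pairing n → ℂ)
    (h : MemLp (fun x : PairingLimit => φ (x.coord n)) 2 (mu (sq_norm_pos hz))) :
    h.toLp _ ∈ (coordEmbedding hz n).toLinearMap.range := by
  let ψ : Pairing n → ℂ := fun y => φ y / y.rootDensity z
  have hψ : MemLp ψ 2 (Pairing.haar n) := MemLp.of_discrete
  refine ⟨hψ.toLp ψ, Lp.ext ?_⟩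
  filter_upwards [coeFn_coordEmbedding hz n (hψ.toLp ψ), h.coeFn_toLp] with x h₁ h₂
  refine h₁.trans ?_
  rw [h₂, Pairing.ae_haar.1 hψ.coeFn_toLp]
  exact mul_div_cancel₀ _ (Pairing.rootDensity_ne_zero hz _)

theorem iSup_range_coordEmbedding_dense :
    (⨆ n, (coordEmbedding hz (n + 1)).toLinearMap.range).topologicalClosure = ⊤ := by
  have : Fact ((2 : ℝ≥0∞) ≠ ∞) := ⟨ENNReal.ofNat_ne_top⟩
  rw [eq_top_iff]
  rintro f -
  set M := ⨆ n, (coordEmbedding hz (n + 1)).toLinearMap.range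
  -- A closed subspace is everything once it contains the constant multiples of indicators. These
  -- are limits of the same for cylinders, which are functions of a single coordinate.
  refine Lp.induction ENNReal.ofNat_ne_top (fun f => f ∈ M.topologicalClosure) ?_ ?_ ?_ f
  · intro c s hs hμs
    rw [Lp.simpleFunc.coe_indicatorConst]
    have hd := measureDense_cylinders (sq_norm_pos hz)
    refine closure_mono ?_ (hd.indicatorConstLp_subset_closure (p := 2) c ⟨s, hs, hμs.ne, rfl⟩)
    rintro _ ⟨_, ⟨n, S, rfl⟩, hμ, rfl⟩
    exact Submodule.mem_iSup_of_mem n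
      (toLp_comp_coord_mem_range hz (n + 1) (S.indicator fun _ => c) _)
  · intro f g hf hg _ h₁ h₂
    exact add_mem h₁ h₂
  · exact M.isClosed_topologicalClosure

end CoordEmbedding

end PairingLimit

/-! ### The properties of L_z^{(n)} and the equivalence, read off from the V_n. -/

theorem norm_Lz {z : ℂ} (hz : z ≠ 0) (n : ℕ) (f : L2 n) : ‖Lz z n f‖ = ‖f‖ := by
  rw [← (PairingLimit.coordEmbedding hz (n + 1)).norm_map, PairingLimit.coordEmbedding_Lz,
    LinearIsometry.norm_map]

theorem Lz_Reg {z : ℂ} (hz : z ≠ 0) (n : ℕ) (g : S2 n) (f : L2 n) :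
    Lz z n (Reg n g f) = Reg (n + 1) (Subgroup.inclusion (S2_mono n.le_succ) g) (Lz z n f) := by
  have hg : (g : (Equiv.Perm ℤ)ᵐᵒᵖ) ∈ S2 (n + 1) := S2_mono n.le_succ g.2
  -- The union defining S(2∞) starts with S(2), so membership goes through S(2n+2), which also
  -- covers `n = 0`.
  let γ : S2inf := ⟨g, le_iSup (fun n => S2 (n + 1)) n hg⟩
  -- After V_{n+1} is applied, both sides become T_{z,1/2}(g) V_n f.
  refine (PairingLimit.coordEmbedding hz (n + 1)).injective ?_
  rw [PairingLimit.coordEmbedding_Lz]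
  refine (PairingLimit.coordEmbedding_Reg hz n γ g.2 f).trans ?_
  rw [← PairingLimit.coordEmbedding_Lz]
  exact (PairingLimit.coordEmbedding_Reg hz (n + 1) γ hg (Lz z n f)).symm

end

theorem mainTheorem6 (z : ℂ) (hz : z ≠ 0) :
    ∃ (isometric : ∀ (n : ℕ) (f : L2 (n + 1)), ‖Lz z (n + 1) f‖ = ‖f‖)
      (intertwines : ∀ (n : ℕ) (g : S2 (n + 1)) (f : L2 (n + 1)),
        Lz z (n + 1) (Reg (n + 1) g f)
          = Reg (n + 2) (Subgroup.inclusion (S2_succ_mono n.le_succ) g) (Lz z (n + 1) f)),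
      UnitaryRep.Equivalent
        (IndLim.rep (fun n => (⟨Lz z (n + 1), isometric n⟩ : L2 (n + 1) →ₗᵢ[ℂ] L2 (n + 2)))
          S2_succ_mono (fun n => Reg (n + 1)) intertwines)
        (Tz hz) :=
  ⟨fun n => norm_Lz hz (n + 1), fun n => Lz_Reg hz (n + 1),
    IndLim.rep_equivalent _ S2_succ_mono _ _ (Tz hz)
      (fun n => PairingLimit.coordEmbedding hz (n + 1))
      (fun n => PairingLimit.coordEmbedding_Lz hz (n + 1))
      (fun n => PairingLimit.coordEmbedding_Reg hz (n + 1))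
      (PairingLimit.iSup_range_coordEmbedding_dense hz)⟩
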